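/- Let $m\ge 0$ be an integer, $n=2m$, $\hbar>0$, $u=(u_1,\dots,u_n)\in\mathbb C^{n}$ (row vectors), $\langle a,b\rangle=\sum_k a_kb_k$, $J=\begin{pmatrix}0&-I\\ I&0\end{pmatrix}$, let $K$ be a complex symmetric $n\times n$ matrix, and let $g\in Sp(m,\mathbb C)=\{g: gJ\,{}^tg=J\}$. *Star exponential.* With $\Lambda=K+J$ let $f*_Kh=\sum_k\frac{(i\hbar)^k}{k!\,2^k}\sum\Lambda_{i_1j_1}\cdots\Lambda_{i_kj_k}\,\partial_{i_1}\cdots\partial_{i_k}f\;\partial_{j_1}\cdots\partial_{j_k}h$ (for $f$ or $h$ a polynomial), and let $H_K=\frac1{2i\hbar}\sum_k (ug)_k*_K(ug)_k$ be the $K$-ordered expression of $\frac1{2i\hbar}\langle ug,ug\rangle_*$. The $K$-ordered star exponential ${:}e_*^{t\frac1{2i\hbar}\langle ug,ug\rangle_*}{:}_K$ along a path in the complex $t$-plane starting at $0$ is the analytic continuation along the path of the solution of $\frac{d}{dt}f_t=H_K*_Kf_t$, $f_0=1$ (holomorphic in $t$, entire in $u$). Put $D(t)=\det\!\big(\cos\tfrac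 t2\,I-\sin\tfrac t2\,{}^tgKg\big)$; the zeros of $D$ are called the singular points. For a continuous path $\gamma=[0\sim\pi]$ from $0$ to $\pi$ avoiding the singular points, the polar element ${:}e_*^{[0\sim\pi]\frac1{2i\hbar}\langle ug,ug\rangle_*}{:}_K$ is the value at the end point of the star exponential along $\gamma$. *Delta function.* Let $V=\{e^{i\theta}xT : x\in\mathbb R^{n}\}$ with $\theta\in\mathbb R$, $T\in O(n,\mathbb C)$ and $VJ=V$ (so that $\mathbb C^{n}=V\oplus iV$), and write $K\in\mathfrak H_+(V)$ if $\frac1\hbar\operatorname{Re}\langle\xi(iK),\xi\rangle\ge c|\xi|^2$ for all $\xi\in V$, for some $c>0$. For $K\in\mathfrak H_+(V)$ let $${:}\delta_*^{(V)}(u){:}_K=\frac1{(2\pi\hbar)^{m}}\int_V e^{\frac1{4i\hbar}\langle\xi K,\xi\rangle+\frac1{i\hbar}\langle\xi,u\rangle}\,dV_\xi,\qquad dV_\xi=e^{2im\theta}dx\quad(\xi=e^{i\theta}xT).$$ *Slits.* A system of slits is a closed set $\Sigma\subset\mathbb C$ together with a continuous branch $r$ of $\sqrt{D}$ on $\mathbb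 C\setminus\Sigma$ which has no limit at any point $p\in\Sigma$ with $D(p)\ne0$. A path $\gamma$ crosses $\Sigma$ at time $s$ if $\gamma(s)\in\Sigma$ and $\gamma(s)$ has arbitrarily small open neighbourhoods $U$ such that $U\setminus\Sigma$ is the union of two disjoint open connected sides $A,B$, with $\gamma$ in $A$ just before and in $B$ just after the time $s$. **Theorem.** There is a function $\gamma\mapsto c(\gamma)$, depending only on $\hbar,K,g$ (and not on $V$), such that: 1. For every path $\gamma=[0\sim\pi]$ avoiding the singular points, $c(\gamma)\in\{1,-1,i,-i\}$, the $K$-ordered star exponential along $\gamma$ exists and is unique, and for every $V$ with $K\in\mathfrak H_+(V)$ $${:}e_*^{[0\sim\pi]\frac1{2i\hbar}\langle ug,ug\rangle_*}{:}_K=c(\gamma)\,2^{-m}\,{:}\delta^{(V)}_*(u){:}_K .$$ Thus the polar element is one of $\pm2^{-m}\delta_*(u)$, $\pm i\,2^{-m}\delta_*(u)$, and the constant is determined by $K$ and the path of the star exponential. 2. For every system of slits $\Sigma$ with $0,\pi\notin\Sigma$ there is $c_0\in\{1,-1,i,-i\}$, depending only on $\hbar,K,g,\Sigma$ and its branch,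 such that for every path $\gamma=[0\sim\pi]$ which avoids the singular points, meets $\Sigma$ at finitely many times only, and crosses $\Sigma$ at each of the $N$ times at which it meets $\Sigma$, one has $c(\gamma)=(-1)^{N}c_0$. Thus, for given $K$ and $g$, the constant depends on such a path only through the parity of the number of slit crossings. -/

import Mathlib

open Matrix Topology Filter

noncomputable section

namespace PolarElement

/-- Index set of the `2m` coordinates `u = (ũ₁,…,ũₘ,ṽ₁,…,ṽₘ)`. -/
abbrev Idx (m : ℕ) : Type := Fin m ⊕ Fin m

/-- Iterated partial derivative `∂_{i₁} ⋯ ∂_{iₖ} f` at `u`. -/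
def partialD {m k : ℕ} (i : Fin k → Idx m) (f : (Idx m → ℂ) → ℂ) (u : Idx m → ℂ) : ℂ :=
  iteratedFDeriv ℂ k f u (fun a => Pi.single (i a) 1)

/-- The `*_K`-product: with `Λ = K + J`,
`f *_K g = ∑ₖ (iħ)ᵏ / (k! 2ᵏ) Λ_{i₁j₁} ⋯ Λ_{iₖjₖ} (∂_{i₁} ⋯ ∂_{iₖ} f) (∂_{j₁} ⋯ ∂_{jₖ} g)`.
The sum over `k` is finite when one of the factors is a polynomial, the only case used. -/
def starMul {m : ℕ} (ħ : ℝ) (K : Matrix (Idx m) (Idx m) ℂ) (f g : (Idx m → ℂ) → ℂ) :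
    (Idx m → ℂ) → ℂ :=
  fun u => ∑' k : ℕ, (Complex.I * ħ) ^ k / ((k.factorial : ℂ) * 2 ^ k) *
    ∑ i : Fin k → Idx m, ∑ j : Fin k → Idx m,
      (∏ a, (K + Matrix.J (Fin m) ℂ) (i a) (j a)) * partialD i f u * partialD j g u

/-- The `K`-ordered expression of `(1 / 2iħ) ⟨ug, ug⟩_* = (1 / 2iħ) ∑ₖ (ug)ₖ * (ug)ₖ`. -/
def quadHam {m : ℕ} (ħ : ℝ) (K g : Matrix (Idx m) (Idx m) ℂ) : (Idx m → ℂ) → ℂ :=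
  fun u => 1 / (2 * Complex.I * ħ) *
    ∑ k, starMul ħ K (fun v => (v ᵥ* g) k) (fun v => (v ᵥ* g) k) u

/-- `F s` is the value at `γ s` of the `K`-ordered `*`-exponential `:e_*^{t H}:_K` continued
analytically along the path `γ` from `0`: it is `1` at the start, and near each point of the path it
is given by a function `Φ t u`, holomorphic in `(t, u)` and entire in `u`, that solves the evolution
equation `dΦ/dt = H *_K Φ`. -/
def IsStarExpAlong {m : ℕ} (ħ : ℝ) (K : Matrix (Idx m) (Idx m) ℂ) (H : (Idx m → ℂ) → ℂ)
    {a : ℂ} (γ : Path (0 : ℂ) a) (F : unitInterval → (Idx m → ℂ) → ℂ) : Prop :=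
  (∀ u, F 0 u = 1) ∧
  ∀ s : unitInterval, ∃ U : Set ℂ, IsOpen U ∧ γ s ∈ U ∧
    ∃ Φ : ℂ → (Idx m → ℂ) → ℂ,
      AnalyticOnNhd ℂ (fun p : ℂ × (Idx m → ℂ) => Φ p.1 p.2) (U ×ˢ Set.univ) ∧
      (∀ t ∈ U, ∀ u, HasDerivAt (fun z => Φ z u) (starMul ħ K H (Φ t) u) t) ∧
      ∀ᶠ s' in 𝓝 s, ∀ u, F s' u = Φ (γ s') u

/-- `det (cos (t/2) I - sin (t/2) ᵗg K g)`. The amplitude of `:e_*^{t (1/2iħ) ⟨ug, ug⟩_*}:_K` is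
the inverse of a square root of this function; its zeros are the singular points in the `t`-plane. -/
def ampDet {m : ℕ} (K g : Matrix (Idx m) (Idx m) ℂ) (t : ℂ) : ℂ :=
  (Complex.cos (t / 2) • (1 : Matrix (Idx m) (Idx m) ℂ)
    - Complex.sin (t / 2) • (gᵀ * K * g)).det

/-- A path from `0` to `π` in the `t`-plane. -/
abbrev PiPath : Type := Path (0 : ℂ) (Real.pi : ℂ)

/-- The path avoids the singular points. -/
def Avoids {m : ℕ} (K g : Matrix (Idx m) (Idx m) ℂ) (γ : PiPath) : Prop :=
  ∀ s, ampDet K g (γ s) ≠ 0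

/-- A system of slits in the plane for the two-valued function `√D`: off the closed set `slits`
a univalent continuous branch of `√D` is given, and across the slits this branch is really
discontinuous (so that passing a slit means passing to the other sheet). -/
structure SlitSystem (D : ℂ → ℂ) where
  slits : Set ℂ
  isClosed_slits : IsClosed slits
  branch : ℂ → ℂ
  continuousOn_branch : ContinuousOn branch slitsᶜ
  branch_sq : ∀ t ∉ slits, branch t ^ 2 = D t
  no_limit : ∀ t ∈ slits, D t ≠ 0 → ¬ ∃ l : ℂ, Tendsto branch (𝓝[slitsᶜ] t) (𝓝 l)

/-- At time `s` the path passes from one side of `S` to the other: arbitrarily small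
neighbourhoods of `γ s` are cut by `S` into two sides `A`, `B`, and `γ` is in `A` just before and
in `B` just after `s`. -/
def CrossesAt (S : Set ℂ) (γ : PiPath) (s : unitInterval) : Prop :=
  ∀ W ∈ 𝓝 (γ s), ∃ U ⊆ W, IsOpen U ∧ γ s ∈ U ∧
    ∃ A B : Set ℂ, IsOpen A ∧ IsOpen B ∧ IsPreconnected A ∧ IsPreconnected B ∧ Disjoint A B ∧
      U \ S = A ∪ B ∧ (∀ᶠ s' in 𝓝[<] s, γ s' ∈ A) ∧ (∀ᶠ s' in 𝓝[>] s, γ s' ∈ B)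

/-- The times at which the path is on `S`. -/
def meetTimes (S : Set ℂ) (γ : PiPath) : Set unitInterval := {s | γ s ∈ S}

/-- The path meets `S` finitely often, and each time it crosses `S`. The number of crossings is
then `(meetTimes S γ).ncard`. -/
def CrossesFinitely (S : Set ℂ) (γ : PiPath) : Prop :=
  (meetTimes S γ).Finite ∧ ∀ s ∈ meetTimes S γ, CrossesAt S γ s

/-- The point `e^{iθ} x T` with real coordinates `x` in the frame `e^{iθ} T`
(the frame vectors are the rows). -/
def framePoint {m : ℕ} (θ : ℝ) (T : Matrix (Idx m) (Idx m) ℂ) (x : Idx m → ℝ) : Idx m → ℂ :=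
  Complex.exp (Complex.I * θ) • ((fun k => (x k : ℂ)) ᵥ* T)

/-- A real `2m`-dimensional subspace `V` of `ℂ^{2m}`, the real span of an orthonormal frame `T`
for the canonical bilinear form (`T ∈ O(2m, ℂ)`), turned by a phase `e^{iθ}`, with `JV = V`.
The property `ℂ^{2m} = V ⊕ iV` is automatic, because `T` is invertible. The cases
`V = ℝ^{2m}`, `(iℝ)^{2m}` and `(i^{-1/2} ℝ)^{2m}` are `T = 1` and `θ = 0, π/2, -π/4`. -/
structure VSpace (m : ℕ) where
  θ : ℝ
  T : Matrix (Idx m) (Idx m) ℂ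
  orth : T * Tᵀ = 1
  J_inv : (fun ξ => ξ ᵥ* Matrix.J (Fin m) ℂ) '' Set.range (framePoint θ T)
    = Set.range (framePoint θ T)

/-- The real subspace itself. -/
def VSpace.carrier {m : ℕ} (V : VSpace m) : Set (Idx m → ℂ) :=
  Set.range (framePoint V.θ V.T)

/-- `K ∈ ℌ₊(V)`: `K` is symmetric and the real part of `iK` is positive definite on `V`. -/
def VClass {m : ℕ} (ħ : ℝ) (V : VSpace m) (K : Matrix (Idx m) (Idx m) ℂ) : Prop :=
  K.IsSymm ∧ ∃ c : ℝ, 0 < c ∧ ∀ ξ ∈ V.carrier,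
    c * ∑ k, ‖ξ k‖ ^ 2 ≤ 1 / ħ * ((ξ ᵥ* (Complex.I • K)) ⬝ᵥ ξ).re

/-- `:e_*^{(1/iħ) ⟨ξ, u⟩}:_K = e^{(1/4iħ) ⟨ξK, ξ⟩ + (1/iħ) ⟨ξ, u⟩}`. -/
def starExpLin {m : ℕ} (ħ : ℝ) (K : Matrix (Idx m) (Idx m) ℂ) (ξ u : Idx m → ℂ) : ℂ :=
  Complex.exp (1 / (4 * Complex.I * ħ) * ((ξ ᵥ* K) ⬝ᵥ ξ) + 1 / (Complex.I * ħ) * (ξ ⬝ᵥ u))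

/-- `:δ_*^{(V)}(u):_K = ∫_V :e_*^{(1/iħ) ⟨ξ, u⟩}:_K dV_ξ / (2πħ)^m`. The volume element of
`V` is `dV = e^{2imθ} dx` in the coordinates `x` of the frame, as results from
`dξ₁ ∧ ⋯ ∧ dξ₂ₘ` by the substitution `ξ = e^{iθ} x T` with `det T = 1`. It depends on `V` only:
for a given `V` the phase `θ` is unique mod `π`, and `T` up to a factor in `O(2m, ℝ)`. -/
def starDelta {m : ℕ} (ħ : ℝ) (V : VSpace m) (K : Matrix (Idx m) (Idx m) ℂ) (u : Idx m → ℂ) : ℂ :=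
  1 / (2 * Real.pi * ħ : ℂ) ^ m * (Complex.exp (Complex.I * V.θ) ^ (2 * m) *
    ∫ x : Idx m → ℝ, starExpLin ħ K (framePoint V.θ V.T x) u)

end PolarElement

end

/-! Both sides are explicit Gaussians, and only the sign of a square root has to be followed.

Put L = ᵗgKg and Y = (cos(t/2) - sin(t/2) L)⁻¹. Since H is quadratic, H *_K is a second order
differential operator in u, and it maps a Gaussian to a quadratic polynomial times that Gaussian.
Hence r⁻¹ exp((1/iħ)⟨uQ,u⟩) with r² = D(t) and Q = sin(t/2) g Y ᵗg solves the evolution equation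
once Q satisfies a Riccati equation (`riccati_phaseMatrix`) and the trace term equals -2D'/D
(`trace_phaseMatrix`, `hasDerivAt_det_ampMatrix`). The equation determines all t-derivatives of an
analytic solution at a point, so the continuation along a path is unique (`evolution_unique`,
`IsStarExpAlong.unique`).

At t = π one has D = det K and Q = -K⁻¹, because the size is even and det g = 1. The polar element
is therefore w⁻¹ exp(-(1/iħ)⟨uK⁻¹,u⟩), where w is the square root of det K reached by continuing √D
from the value 1 along γ. The delta function is ζ times the same exponential, with ζ² det K = (-4)^m
(`PosOn.starDelta_zero_sq`). So c(γ) = 2^m / (wζ) satisfies c² = (-1)^m. The path enters only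
through the sign of w, and each slit crossing flips that sign relative to the given branch
(`SlitSystem.continuation_eq`).

It remains to see that ζ does not depend on V. Its square does not, so only a sign is at stake.
Averaging K over conjugation by J keeps it in the positive cone of every admissible V, since VJ = V.
For a matrix commuting with J, det has a canonical square root, the determinant on an eigenspace of
J, and the Gaussian integral selects this root whatever V is (`PosOn.starDelta_meanJ`). Continuity
along the segment from the average to K transports the equality of signs
(`PosOn.starDelta_zero_eq`). -/

noncomputable section

namespace PolarElement

/-! ### Gaussian integrals with complex symmetric matrices -/

section Gaussian

variable {ι : Type*}

/-- The complexification of a real vector. -/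
def cvec (x : ι → ℝ) : ι → ℂ := fun k => (x k : ℂ)

lemma continuous_cvec : Continuous (cvec : (ι → ℝ) → ι → ℂ) := by
  unfold cvec; fun_prop

variable [Fintype ι]

/-- The quadratic form `x M ᵗx`. -/
def qform (M : Matrix ι ι ℂ) (x : ι → ℂ) : ℂ := (x ᵥ* M) ⬝ᵥ x

/-- A complex symmetric matrix whose real part is positive definite. -/
def RePos (M : Matrix ι ι ℂ) : Prop :=
  M.IsSymm ∧ ∀ x : ι → ℝ, x ≠ 0 → 0 < (qform M (cvec x)).re

/-- The Gaussian integral `∫ exp (-x M ᵗx + b ᵗx) dx`. -/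
def gaussInt (M : Matrix ι ι ℂ) (b : ι → ℂ) : ℂ :=
  ∫ x : ι → ℝ, Complex.exp (-qform M (cvec x) + b ⬝ᵥ cvec x)

lemma qform_add (M N : Matrix ι ι ℂ) (x : ι → ℂ) : qform (M + N) x = qform M x + qform N x := by
  simp [qform, Matrix.vecMul_add]

lemma qform_smul (a : ℂ) (M : Matrix ι ι ℂ) (x : ι → ℂ) : qform (a • M) x = a * qform M x := by
  simp [qform, Matrix.vecMul_smul]

lemma qform_eq_sum (M : Matrix ι ι ℂ) (x : ι → ℂ) :
    qform M x = ∑ i, ∑ j, M i j * x i * x j := by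
  simp only [qform, dotProduct, vecMul, Finset.sum_mul]
  rw [Finset.sum_comm]
  exact Finset.sum_congr rfl fun i _ => Finset.sum_congr rfl fun j _ => by ring

/-- `(x C) M ᵗ(x C) = x (C M ᵗC) ᵗx`. -/
lemma qform_vecMul (M C : Matrix ι ι ℂ) (x : ι → ℂ) :
    qform M (x ᵥ* C) = qform (C * M * Cᵀ) x := by
  simp only [qform, ← Matrix.vecMul_vecMul]
  rw [← Matrix.mulVec_transpose C x, Matrix.dotProduct_mulVec]

lemma continuous_qform (M : Matrix ι ι ℂ) : Continuous (qform M) := by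
  simp_rw [funext (qform_eq_sum M)]
  fun_prop

lemma cvec_vecMul (x : ι → ℝ) (C : Matrix ι ι ℝ) :
    cvec (x ᵥ* C) = cvec x ᵥ* C.map Complex.ofReal := by
  funext k
  simp [cvec, vecMul, dotProduct]

lemma RePos.combo {M N : Matrix ι ι ℂ} (hM : RePos M) (hN : RePos N) {t : ℝ}
    (ht : t ∈ Set.Icc (0 : ℝ) 1) : RePos ((1 - t : ℂ) • M + (t : ℂ) • N) := by
  refine ⟨by
    simp only [Matrix.IsSymm, Matrix.transpose_add, Matrix.transpose_smul, hM.1.eq, hN.1.eq], ?_⟩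
  intro x hx
  have h1 := hM.2 x hx
  have h2 := hN.2 x hx
  have : (qform ((1 - t : ℂ) • M + (t : ℂ) • N) (cvec x)).re =
      (1 - t) * (qform M (cvec x)).re + t * (qform N (cvec x)).re := by
    rw [qform_add, qform_smul, qform_smul]
    simp
  rw [this]
  rcases ht.1.eq_or_lt with h | h
  · rw [← h]; simpa using h1
  · nlinarith [mul_pos h h2, mul_nonneg (sub_nonneg.2 ht.2) h1.le]

variable [DecidableEq ι]

lemma exists_orthogonal_diagonalization {A : Matrix ι ι ℝ} (hA : A.IsSymm) :
    ∃ U : Matrix ι ι ℝ, ∃ d : ι → ℝ, U * Uᵀ = 1 ∧ U * A * Uᵀ = diagonal d := by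
  have hH : A.IsHermitian := by
    rw [Matrix.IsHermitian, Matrix.conjTranspose_eq_transpose_of_trivial]; exact hA
  refine ⟨star (hH.eigenvectorUnitary : Matrix ι ι ℝ), hH.eigenvalues, ?_, ?_⟩
  · have := (Matrix.mem_unitaryGroup_iff'.1 hH.eigenvectorUnitary.2)
    rwa [Matrix.star_eq_conjTranspose, Matrix.conjTranspose_eq_transpose_of_trivial,
      Matrix.transpose_transpose, ← Matrix.conjTranspose_eq_transpose_of_trivial,
      ← Matrix.star_eq_conjTranspose]
  · have := hH.conjStarAlgAut_star_eigenvectorUnitary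
    simp only [Unitary.conjStarAlgAut_apply] at this
    simpa [Matrix.star_eq_conjTranspose, Matrix.conjTranspose_eq_transpose_of_trivial,
      Function.comp_def] using this

/-- An orthogonal diagonalization of P followed by a rescaling turns P into 1; a further orthogonal
change of variables then diagonalizes Q and leaves 1 unchanged. -/
lemma exists_simultaneous_diagonalization {P Q : Matrix ι ι ℝ} (hP : P.IsSymm) (hQ : Q.IsSymm)
    (hpos : ∀ x : ι → ℝ, x ≠ 0 → 0 < (x ᵥ* P) ⬝ᵥ x) :
    ∃ C : Matrix ι ι ℝ, ∃ q : ι → ℝ, C.det ≠ 0 ∧ C * P * Cᵀ = 1 ∧ C * Q * Cᵀ = diagonal q := by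
  obtain ⟨U, d, hU, hd⟩ := exists_orthogonal_diagonalization hP
  have hd0 : ∀ k, 0 < d k := by
    intro k
    have h1 : d k = ((Pi.single k 1 ᵥ* U) ᵥ* P) ⬝ᵥ (Pi.single k 1 ᵥ* U) := by
      rw [← Matrix.mulVec_transpose U, Matrix.dotProduct_mulVec, Matrix.mulVec_transpose,
        Matrix.vecMul_vecMul, Matrix.vecMul_vecMul, ← Matrix.mul_assoc, hd]
      simp
    rw [h1]
    apply hpos
    intro h0
    have h2 : (Pi.single k (1:ℝ) ᵥ* U) ᵥ* Uᵀ = 0 := by rw [h0]; simp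
    rw [Matrix.vecMul_vecMul, hU] at h2
    simpa using congrFun h2 k
  set S : Matrix ι ι ℝ := diagonal fun k => (Real.sqrt (d k))⁻¹ with hS
  set C1 := S * U with hC1
  have hC1P : C1 * P * C1ᵀ = 1 := by
    have : C1 * P * C1ᵀ = S * (U * P * Uᵀ) * S := by
      simp only [hC1, hS, Matrix.transpose_mul, Matrix.diagonal_transpose, Matrix.mul_assoc]
    rw [this, hd, hS, Matrix.diagonal_mul_diagonal, Matrix.diagonal_mul_diagonal,
      ← Matrix.diagonal_one]
    congr 1
    funext k
    have := Real.mul_self_sqrt (hd0 k).le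
    have h3 : Real.sqrt (d k) ≠ 0 := (Real.sqrt_pos.2 (hd0 k)).ne'
    field_simp
    rw [sq, this]
  have hQ1 : (C1 * Q * C1ᵀ).IsSymm := by
    simp only [Matrix.IsSymm, Matrix.transpose_mul, Matrix.transpose_transpose, hQ.eq,
      Matrix.mul_assoc]
  obtain ⟨W, q, hW, hq⟩ := exists_orthogonal_diagonalization hQ1
  have key : ∀ N : Matrix ι ι ℝ, (W * C1) * N * (W * C1)ᵀ = W * (C1 * N * C1ᵀ) * Wᵀ := by
    intro N; simp only [Matrix.transpose_mul, Matrix.mul_assoc]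
  have h1 : (W * C1) * P * (W * C1)ᵀ = 1 := by rw [key, hC1P, Matrix.mul_one, hW]
  refine ⟨W * C1, q, ?_, h1, by rw [key, hq]⟩
  intro h0
  have := congrArg Matrix.det h1
  rw [Matrix.det_mul, Matrix.det_mul, h0] at this
  simp at this

/-- A complex symmetric matrix with positive definite real part is diagonalized by a real change
of variables. -/
lemma RePos.exists_diagonalization {M : Matrix ι ι ℂ} (hM : RePos M) :
    ∃ C : Matrix ι ι ℝ, ∃ z : ι → ℂ, C.det ≠ 0 ∧ (∀ k, 0 < (z k).re) ∧
      C.map Complex.ofReal * M * (C.map Complex.ofReal)ᵀ = diagonal z := by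
  have hsymm : ∀ i j, M j i = M i j := fun i j => congrFun (congrFun hM.1.eq i) j
  obtain ⟨C, q, hC, h1, h2⟩ := exists_simultaneous_diagonalization
    (P := M.map Complex.re) (Q := M.map Complex.im)
    (by ext i j; simp [hsymm i j]) (by ext i j; simp [hsymm i j])
    (by
      intro x hx
      convert hM.2 x hx using 1
      rw [qform_eq_sum]
      simp only [dotProduct, vecMul, Finset.sum_mul, Complex.re_sum, cvec, Matrix.map_apply]
      rw [Finset.sum_comm]
      refine Finset.sum_congr rfl fun i _ => Finset.sum_congr rfl fun j _ => ?_
      simp only [Complex.mul_re, Complex.ofReal_re, Complex.ofReal_im, mul_zero, sub_zero]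
      ring)
  -- The real part of M becomes 1 and the imaginary part diag(q), so every diagonal entry has real
  -- part 1.
  refine ⟨C, fun k => 1 + q k * Complex.I, hC, by simp, ?_⟩
  ext i j
  have e1 := congrArg Complex.ofReal (congrFun (congrFun h1 i) j)
  have e2 := congrArg Complex.ofReal (congrFun (congrFun h2 i) j)
  simp only [Matrix.mul_apply, Matrix.transpose_apply, Matrix.map_apply, Finset.sum_mul] at e1 e2 ⊢
  have : ∀ a b, (C i b : ℂ) * M b a * C j a =
      ((C i b * (M b a).re * C j a : ℝ) : ℂ) + ((C i b * (M b a).im * C j a : ℝ) : ℂ) * Complex.I := by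
    intro a b
    conv_lhs => rw [← Complex.re_add_im (M b a)]
    push_cast; ring
  simp only [this, Finset.sum_add_distrib, ← Finset.sum_mul _ _ Complex.I, ← Complex.ofReal_sum,
    e1, e2]
  by_cases hij : i = j
  · subst hij; simp
  · simp [hij]

lemma measurableEmbedding_toLin' {C : Matrix ι ι ℝ} (hC : C.det ≠ 0) :
    MeasurableEmbedding (toLin' C) :=
  ((Matrix.toLinearEquiv' C (Matrix.invertibleOfIsUnitDet _
    (isUnit_iff_ne_zero.2 hC))).toContinuousLinearEquiv.toHomeomorph).measurableEmbedding

lemma det_map_ofReal (C : Matrix ι ι ℝ) : (C.map Complex.ofReal).det = (C.det : ℂ) :=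
  (RingHom.map_det Complex.ofRealHom C).symm

lemma integral_comp_vecMul (C : Matrix ι ι ℝ) (hC : C.det ≠ 0) (f : (ι → ℝ) → ℂ) :
    ∫ x, f x = |C.det| • ∫ x, f (x ᵥ* C) := by
  have hC' : (Cᵀ).det ≠ 0 := by rwa [Matrix.det_transpose]
  have h := Real.map_matrix_volume_pi_eq_smul_volume_pi hC'
  have hem := measurableEmbedding_toLin' hC'
  have h2 := hem.integral_map (μ := MeasureTheory.volume) f
  rw [h, MeasureTheory.integral_smul_measure] at h2
  simp only [Matrix.toLin'_apply, Matrix.mulVec_transpose] at h2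
  rw [← h2, smul_smul, ENNReal.toReal_ofReal (abs_nonneg _), Matrix.det_transpose, abs_inv,
    mul_inv_cancel₀ (abs_ne_zero.2 hC), one_smul]

lemma integrand_comp_vecMul {M : Matrix ι ι ℂ} {C : Matrix ι ι ℝ} {z : ι → ℂ}
    (hz : C.map Complex.ofReal * M * (C.map Complex.ofReal)ᵀ = diagonal z) (b : ι → ℂ)
    (x : ι → ℝ) :
    -qform M (cvec (x ᵥ* C)) + b ⬝ᵥ cvec (x ᵥ* C) =
      -∑ i, z i * (x i : ℂ) ^ 2 + ∑ i, (C.map Complex.ofReal *ᵥ b) i * x i := by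
  rw [cvec_vecMul, qform_vecMul, hz, dotProduct_comm b, ← Matrix.dotProduct_mulVec]
  congr 1
  · simp only [qform, Matrix.vecMul_diagonal, dotProduct, cvec]
    congr 1
    exact Finset.sum_congr rfl fun i _ => by ring
  · rw [dotProduct_comm]; rfl

lemma RePos.integrable {M : Matrix ι ι ℂ} (hM : RePos M) (b : ι → ℂ) :
    MeasureTheory.Integrable
      fun x : ι → ℝ => Complex.exp (-qform M (cvec x) + b ⬝ᵥ cvec x) := by
  obtain ⟨C, z, hC, hz0, hz⟩ := hM.exists_diagonalization
  have hC' : (Cᵀ).det ≠ 0 := by rwa [Matrix.det_transpose]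
  have h := Real.map_matrix_volume_pi_eq_smul_volume_pi hC'
  have hem := measurableEmbedding_toLin' hC'
  have h2 := (hem.integrable_map_iff (μ := MeasureTheory.volume)
    (g := fun x : ι → ℝ => Complex.exp (-qform M (cvec x) + b ⬝ᵥ cvec x)))
  have h3 := GaussianFourier.integrable_cexp_neg_sum_mul_add hz0 (C.map Complex.ofReal *ᵥ b)
  simp only [Function.comp_def, Matrix.toLin'_apply, Matrix.mulVec_transpose,
    integrand_comp_vecMul hz] at h2
  rw [h, MeasureTheory.integrable_smul_measure (by simpa using hC) (by simp)] at h2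
  exact h2.2 h3

lemma RePos.gaussInt_eq {M : Matrix ι ι ℂ} {C : Matrix ι ι ℝ} {z : ι → ℂ}
    (hC : C.det ≠ 0) (hz0 : ∀ k, 0 < (z k).re)
    (hz : C.map Complex.ofReal * M * (C.map Complex.ofReal)ᵀ = diagonal z) (b : ι → ℂ) :
    gaussInt M b = |C.det| * ∏ i, ((Real.pi / z i) ^ (1 / 2 : ℂ) *
      Complex.exp ((C.map Complex.ofReal *ᵥ b) i ^ 2 / (4 * z i))) := by
  rw [gaussInt, integral_comp_vecMul C hC]
  simp only [integrand_comp_vecMul hz]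
  rw [GaussianFourier.integral_cexp_neg_sum_mul_add hz0]
  simp

/-- Squaring removes the choice of branch in each one-dimensional factor (π/z)^(1/2); the Jacobian
det C² then converts ∏ z into det M. -/
lemma RePos.gaussInt_sq {M : Matrix ι ι ℂ} (hM : RePos M) :
    gaussInt M 0 ^ 2 * M.det = (Real.pi : ℂ) ^ Fintype.card ι := by
  obtain ⟨C, z, hC, hz0, hz⟩ := hM.exists_diagonalization
  have hdet := congrArg Matrix.det hz
  rw [Matrix.det_mul, Matrix.det_mul, Matrix.det_transpose, Matrix.det_diagonal,
    det_map_ofReal] at hdet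
  rw [RePos.gaussInt_eq hC hz0 hz, mul_pow, ← Finset.prod_pow]
  have habs : ((|C.det| : ℝ) : ℂ) ^ 2 = (C.det : ℂ) ^ 2 := by
    rw [← Complex.ofReal_pow, sq_abs, Complex.ofReal_pow]
  have hterm : ∀ i, ((Real.pi / z i : ℂ) ^ (1 / 2 : ℂ) *
      Complex.exp ((C.map Complex.ofReal *ᵥ (0 : ι → ℂ)) i ^ 2 / (4 * z i))) ^ 2
      = Real.pi / z i := by
    intro i
    simp only [Matrix.mulVec_zero, Pi.zero_apply]
    rw [mul_pow, ← Complex.cpow_nat_mul]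
    simp
  have hzne : ∏ i, z i ≠ 0 := Finset.prod_ne_zero_iff.2 fun i _ h => by
    have := hz0 i; rw [h] at this; simp at this
  rw [Finset.prod_congr rfl fun i _ => hterm i, Finset.prod_div_distrib, habs,
    Finset.prod_const, Finset.card_univ]
  field_simp
  rw [← hdet]; ring

lemma RePos.det_ne_zero {M : Matrix ι ι ℂ} (hM : RePos M) : M.det ≠ 0 := by
  intro h
  have := hM.gaussInt_sq
  rw [h, mul_zero] at this
  exact pow_ne_zero _ (by simp) this.symm

/-- Completing the square, coordinate by coordinate after diagonalization, where M⁻¹ = ᵗC diag(z⁻¹)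
C. -/
lemma RePos.gaussInt_eq_mul_exp {M : Matrix ι ι ℂ} (hM : RePos M) (b : ι → ℂ) :
    gaussInt M b = gaussInt M 0 * Complex.exp (qform M⁻¹ b / 4) := by
  obtain ⟨C, z, hC, hz0, hz⟩ := hM.exists_diagonalization
  have hzne : ∀ i, z i ≠ 0 := fun i h => by
    have := hz0 i; rw [h] at this; simp at this
  have hmap : (C.map Complex.ofReal).det ≠ 0 := by
    rw [det_map_ofReal]; exact_mod_cast hC
  set D := C.map Complex.ofReal
  have hinv : M⁻¹ = Dᵀ * diagonal (fun i => (z i)⁻¹) * D := by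
    have hu : IsUnit D.det := isUnit_iff_ne_zero.2 hmap
    have hut : IsUnit (Dᵀ).det := by rwa [Matrix.det_transpose]
    apply Matrix.inv_eq_right_inv
    have h1 : D * M = diagonal z * (Dᵀ)⁻¹ := by
      rw [← hz, Matrix.mul_assoc (D * M), Matrix.mul_nonsing_inv _ hut, Matrix.mul_one]
    have h2 : D * (M * (Dᵀ * diagonal (fun i => (z i)⁻¹) * D)) = D := by
      rw [← Matrix.mul_assoc, h1, Matrix.mul_assoc, Matrix.mul_assoc Dᵀ, ← Matrix.mul_assoc (Dᵀ)⁻¹,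
        Matrix.nonsing_inv_mul _ hut, Matrix.one_mul, ← Matrix.mul_assoc,
        Matrix.diagonal_mul_diagonal]
      simp [hzne]
    have h3 := congrArg (D⁻¹ * ·) h2
    simpa [← Matrix.mul_assoc, Matrix.nonsing_inv_mul _ hu] using h3
  have hq : qform M⁻¹ b / 4 = ∑ i, (D *ᵥ b) i ^ 2 / (4 * z i) := by
    have : qform M⁻¹ b = qform (diagonal (fun i => (z i)⁻¹)) (b ᵥ* Dᵀ) := by
      rw [hinv, qform_vecMul, Matrix.transpose_transpose]
    rw [this, Matrix.vecMul_transpose]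
    simp only [qform, Matrix.vecMul_diagonal, dotProduct, Finset.sum_div]
    refine Finset.sum_congr rfl fun i _ => ?_
    have := hzne i
    field_simp
  rw [RePos.gaussInt_eq hC hz0 hz, RePos.gaussInt_eq hC hz0 hz, hq, Complex.exp_sum]
  simp only [Matrix.mulVec_zero, Pi.zero_apply, Finset.prod_mul_distrib]
  simp [mul_assoc, D]

lemma gaussInt_one : gaussInt (1 : Matrix ι ι ℂ) 0 = (Real.sqrt Real.pi : ℂ) ^ Fintype.card ι := by
  rw [RePos.gaussInt_eq (C := 1) (z := 1) (by simp) (by simp) (by simp)]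
  simp only [Matrix.det_one, abs_one, Matrix.mulVec_zero, Pi.zero_apply, Pi.one_apply]
  simp [Real.sqrt_eq_rpow, Complex.ofReal_cpow Real.pi_pos.le]

/-- Dominated convergence: the real part of the exponent is a convex combination of those at the
ends of the segment, so the sum of the two end integrands in absolute value is a bound. -/
lemma RePos.continuousOn_gaussInt_combo {M N : Matrix ι ι ℂ} (hM : RePos M) (hN : RePos N) :
    ContinuousOn (fun t : ℝ => gaussInt ((1 - t : ℂ) • M + (t : ℂ) • N) 0) (Set.Icc 0 1) := by
  unfold gaussInt
  refine MeasureTheory.continuousOn_of_dominated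
    (bound := fun x => ‖Complex.exp (-qform M (cvec x) + 0 ⬝ᵥ cvec x)‖
      + ‖Complex.exp (-qform N (cvec x) + 0 ⬝ᵥ cvec x)‖) ?_ ?_ ?_ ?_
  · intro t _
    refine Continuous.aestronglyMeasurable ?_
    have := (continuous_qform ((1 - t : ℂ) • M + (t : ℂ) • N)).comp continuous_cvec
    simp only [Function.comp_def] at this
    simp only [zero_dotProduct, add_zero]
    fun_prop
  · intro t ht
    refine Filter.Eventually.of_forall fun x => ?_
    simp only [zero_dotProduct, add_zero, Complex.norm_exp, qform_add, qform_smul]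
    set a := qform M (cvec x)
    set b := qform N (cvec x)
    have : (-((1 - (t : ℂ)) * a + t * b)).re = -((1 - t) * a.re + t * b.re) := by simp
    rw [this]
    rcases le_total a.re b.re with h | h
    · have : Real.exp (-((1 - t) * a.re + t * b.re)) ≤ Real.exp (-a).re := by
        apply Real.exp_le_exp.2
        simp only [Complex.neg_re]
        nlinarith [ht.1]
      linarith [Real.exp_pos (-b).re]
    · have : Real.exp (-((1 - t) * a.re + t * b.re)) ≤ Real.exp (-b).re := by
        apply Real.exp_le_exp.2
        simp only [Complex.neg_re]
        nlinarith [ht.2]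
      linarith [Real.exp_pos (-a).re]
  · exact (hM.integrable 0).norm.add (hN.integrable 0).norm
  · refine Filter.Eventually.of_forall fun x => ?_
    simp only [qform_add, qform_smul]
    fun_prop

end Gaussian

/-! ### A canonical square root of det for matrices commuting with a complex structure -/

section ComplexStructure

variable {ι : Type*} [DecidableEq ι]

/-- The projection onto an eigenspace of a complex structure `N`, `N² = -1`. -/
def eigenProj (N : Matrix ι ι ℂ) : Matrix ι ι ℂ := (1 / 2 : ℂ) • (1 - Complex.I • N)

lemma eigenProj_transpose {N : Matrix ι ι ℂ} (hN : Nᵀ = -N) :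
    (eigenProj N)ᵀ = 1 - eigenProj N := by
  simp only [eigenProj, Matrix.transpose_smul, Matrix.transpose_sub, Matrix.transpose_one, hN]
  ext i j
  simp only [Matrix.sub_apply, Matrix.smul_apply, Matrix.neg_apply, smul_eq_mul]
  ring

variable [Fintype ι]

/-- The determinant of the restriction of `M` to the eigenspace of `N`, when `M` and `N`
commute. -/
def eigenDet (N M : Matrix ι ι ℂ) : ℂ := (M * eigenProj N + (1 - eigenProj N)).det

lemma eigenProj_idem {N : Matrix ι ι ℂ} (hN : N * N = -1) :
    eigenProj N * eigenProj N = eigenProj N := by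
  simp only [eigenProj, Matrix.smul_mul, Matrix.mul_smul, Matrix.sub_mul, Matrix.mul_sub,
    Matrix.one_mul, Matrix.mul_one, hN, smul_smul, smul_sub]
  have : Complex.I * Complex.I = -1 := Complex.I_mul_I
  ext i j
  simp only [Matrix.sub_apply, Matrix.smul_apply, Matrix.neg_apply, smul_eq_mul]
  linear_combination (1 / 4 : ℂ) * (-(1 : Matrix ι ι ℂ) i j) * this

lemma commute_eigenProj {N M : Matrix ι ι ℂ} (h : Commute M N) : Commute M (eigenProj N) :=
  ((Commute.one_right M).sub_right (h.smul_right _)).smul_right _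

/-- With P the projection, PM'P = M'P and (1 - P)M'P = 0, so the extensions by the identity
multiply. Only the right factor has to preserve the eigenspace. -/
lemma eigenDet_mul {N M M' : Matrix ι ι ℂ} (hN : N * N = -1) (h' : Commute M' N) :
    eigenDet N (M * M') = eigenDet N M * eigenDet N M' := by
  have hc : M' * eigenProj N = eigenProj N * M' := commute_eigenProj h'
  have hi := eigenProj_idem hN
  unfold eigenDet
  rw [← Matrix.det_mul]
  congr 1
  have h1 : eigenProj N * (M' * eigenProj N) = M' * eigenProj N := by
    rw [hc, ← Matrix.mul_assoc, hi]
  simp only [Matrix.add_mul, Matrix.mul_add, Matrix.sub_mul, Matrix.mul_sub, Matrix.one_mul,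
    Matrix.mul_one, Matrix.mul_assoc, hi, h1]
  abel

/-- det M is the product of the determinants on the two eigenspaces. Transposition fixes M and
exchanges the two projections, because N is antisymmetric, so these determinants are equal. -/
lemma eigenDet_sq {N M : Matrix ι ι ℂ} (hN : N * N = -1) (hNt : Nᵀ = -N) (hM : M.IsSymm)
    (h : Commute M N) : eigenDet N M ^ 2 = M.det := by
  have hc : M * eigenProj N = eigenProj N * M := commute_eigenProj h
  have hi := eigenProj_idem hN
  have ht : eigenDet N M = (M * (1 - eigenProj N) + eigenProj N).det := by
    unfold eigenDet
    rw [← Matrix.det_transpose]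
    congr 1
    simp only [Matrix.transpose_add, Matrix.transpose_mul, Matrix.transpose_sub,
      Matrix.transpose_one, eigenProj_transpose hNt, hM.eq, Matrix.mul_sub, Matrix.mul_one, hc]
    abel
  rw [sq]
  nth_rw 2 [ht]
  unfold eigenDet
  rw [← Matrix.det_mul]
  congr 1
  have h1 : eigenProj N * (M * eigenProj N) = M * eigenProj N := by
    rw [hc, ← Matrix.mul_assoc, hi]
  have h2 : eigenProj N * M = M * eigenProj N := hc.symm
  simp only [Matrix.add_mul, Matrix.mul_add, Matrix.sub_mul, Matrix.mul_sub, Matrix.one_mul,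
    Matrix.mul_one, Matrix.mul_assoc, hi, h1, h2]
  abel

lemma eigenDet_one (N : Matrix ι ι ℂ) : eigenDet N 1 = 1 := by simp [eigenDet]

lemma eigenDet_conj {T N M : Matrix ι ι ℂ} (hT : T * Tᵀ = 1) :
    eigenDet (T * N * Tᵀ) (T * M * Tᵀ) = eigenDet N M := by
  have hT' : Tᵀ * T = 1 := mul_eq_one_comm.1 hT
  have hp : eigenProj (T * N * Tᵀ) = T * eigenProj N * Tᵀ := by
    simp only [eigenProj, Matrix.mul_smul, Matrix.smul_mul, Matrix.mul_sub, Matrix.sub_mul,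
      Matrix.mul_one, hT]
  have : T * M * Tᵀ * eigenProj (T * N * Tᵀ) + (1 - eigenProj (T * N * Tᵀ)) =
      T * (M * eigenProj N + (1 - eigenProj N)) * Tᵀ := by
    rw [hp]
    have : T * M * Tᵀ * (T * eigenProj N * Tᵀ) = T * (M * eigenProj N) * Tᵀ := by
      calc T * M * Tᵀ * (T * eigenProj N * Tᵀ) = T * M * (Tᵀ * T) * eigenProj N * Tᵀ := by
            simp only [Matrix.mul_assoc]
        _ = _ := by rw [hT', Matrix.mul_one]; simp only [Matrix.mul_assoc]
    rw [this]
    simp only [Matrix.mul_add, Matrix.add_mul, Matrix.mul_sub, Matrix.sub_mul, Matrix.mul_one, hT]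
  unfold eigenDet
  rw [this, Matrix.det_mul, Matrix.det_mul, mul_right_comm, ← Matrix.det_mul, hT, Matrix.det_one,
    one_mul]

/-- On matrices commuting with a complex structure the square root of the determinant in the
Gaussian integral is the determinant on the eigenspace. -/
lemma RePos.gaussInt_mul_eigenDet {m : ℕ} {N M : Matrix (Idx m) (Idx m) ℂ} (hN : N * N = -1)
    (hNt : Nᵀ = -N) (hM : RePos M) (h : Commute M N) :
    gaussInt M 0 * eigenDet N M = (Real.pi : ℂ) ^ m := by
  have h1 : RePos (1 : Matrix (Idx m) (Idx m) ℂ) := by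
    refine ⟨Matrix.transpose_one, fun x hx => ?_⟩
    have : (qform 1 (cvec x)).re = ∑ i, x i * x i := by
      simp [qform, dotProduct, cvec]
    rw [this]
    obtain ⟨k, hk⟩ := Function.ne_iff.1 hx
    exact Finset.sum_pos' (fun i _ => mul_self_nonneg _) ⟨k, Finset.mem_univ _, mul_self_pos.2 hk⟩
  have hpi : (Real.pi : ℂ) ≠ 0 := by simp
  -- On the segment from 1 to M both sides are continuous with the same nonzero square; they agree
  -- at 1, hence throughout.
  have key := (isPreconnected_Icc (a := (0 : ℝ)) (b := 1)).eq_of_sq_eq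
    (f := fun t : ℝ => gaussInt ((1 - t : ℂ) • 1 + (t : ℂ) • M) 0 *
      eigenDet N ((1 - t : ℂ) • 1 + (t : ℂ) • M))
    (g := fun _ => (Real.pi : ℂ) ^ m) (y := 0) ?_ continuousOn_const ?_
    (fun _ => pow_ne_zero _ hpi) (by simp) ?_
  · have := key (x := 1) (by simp)
    simpa using this
  · refine (h1.continuousOn_gaussInt_combo hM).mul (Continuous.continuousOn ?_)
    unfold eigenDet
    refine Continuous.matrix_det ?_
    fun_prop
  · intro t ht
    have hp := h1.combo hM ht
    have hc : Commute ((1 - t : ℂ) • 1 + (t : ℂ) • M) N :=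
      ((Commute.one_left N).smul_left _).add_left (h.smul_left _)
    simp only [Pi.pow_apply]
    rw [mul_pow, eigenDet_sq hN hNt hp.1 hc, hp.gaussInt_sq]
    simp [← pow_mul, mul_two]
  · simp only [Complex.ofReal_zero, sub_zero, one_smul, zero_smul, add_zero, gaussInt_one,
      eigenDet_one, mul_one]
    rw [Fintype.card_sum, Fintype.card_fin, ← two_mul, pow_mul, ← Complex.ofReal_pow,
      Real.sq_sqrt Real.pi_pos.le]

/-- Each eigenspace of J has dimension m. -/
lemma eigenDet_J_smul (m : ℕ) (a : ℂ) :
    eigenDet (Matrix.J (Fin m) ℂ) (a • (1 : Matrix (Idx m) (Idx m) ℂ)) = a ^ m := by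
  set α : ℂ := (a + 1) / 2
  set β : ℂ := Complex.I * (a - 1) / 2
  have h1 : a • (1 : Matrix (Idx m) (Idx m) ℂ) * eigenProj (Matrix.J (Fin m) ℂ) +
      (1 - eigenProj (Matrix.J (Fin m) ℂ)) =
      fromBlocks (α • 1) (β • 1) (-β • 1) (α • 1) := by
    rw [eigenProj, Matrix.J, ← fromBlocks_one]
    simp only [fromBlocks_smul, sub_eq_add_neg, fromBlocks_neg, fromBlocks_add,
      fromBlocks_multiply]
    congr 1 <;> ext i j <;>
      simp [α, β, Matrix.one_apply] <;> split_ifs <;> ring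
  -- A unipotent shear conjugates the matrix to block triangular form with diagonal blocks 1 and a.
  have h2 : (fromBlocks (α • 1) (β • 1) (-β • 1) (α • 1) : Matrix (Idx m) (Idx m) ℂ) *
      fromBlocks (1 : Matrix (Fin m) (Fin m) ℂ) 0 (Complex.I • 1) 1 =
      fromBlocks (1 : Matrix (Fin m) (Fin m) ℂ) 0 (Complex.I • 1) 1 *
        fromBlocks (1 : Matrix (Fin m) (Fin m) ℂ) (β • 1) 0 (a • 1) := by
    have hI := Complex.I_mul_I
    simp only [fromBlocks_multiply]
    congr 1 <;> ext i j <;>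
      simp [α, β, Matrix.one_apply] <;> split_ifs <;>
      first | ring1 | linear_combination ((a - 1) / 2) * hI | linear_combination ((1 - a) / 2) * hI
  have h3 := congrArg Matrix.det h2
  rw [Matrix.det_mul, Matrix.det_mul, Matrix.det_fromBlocks_zero₁₂, Matrix.det_fromBlocks_zero₂₁]
    at h3
  rw [eigenDet, h1]
  simpa using h3

end ComplexStructure

/-! ### The delta function as a Gaussian, and its independence of V -/

section Delta

variable {m : ℕ}

/-- The matrix of the quadratic form `-(1/4iħ) ⟨ξK, ξ⟩` in the frame of `V`. -/
def frameMatrix (ħ : ℝ) (V : VSpace m) (K : Matrix (Idx m) (Idx m) ℂ) : Matrix (Idx m) (Idx m) ℂ :=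
  (Complex.I * Complex.exp (Complex.I * V.θ) ^ 2 / (4 * ħ)) • (V.T * K * V.Tᵀ)

/-- `iK` has positive definite real part on `V`. -/
def PosOn (V : VSpace m) (K : Matrix (Idx m) (Idx m) ℂ) : Prop :=
  K.IsSymm ∧ ∀ ξ ∈ V.carrier, ξ ≠ 0 → 0 < (Complex.I * qform K ξ).re

lemma VClass.posOn {ħ : ℝ} (hħ : 0 < ħ) {V : VSpace m} {K : Matrix (Idx m) (Idx m) ℂ}
    (h : VClass ħ V K) : PosOn V K := by
  obtain ⟨hK, c, hc, h⟩ := h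
  refine ⟨hK, fun ξ hξ hne => ?_⟩
  have h1 := h ξ hξ
  have h2 : (ξ ᵥ* (Complex.I • K)) ⬝ᵥ ξ = Complex.I * qform K ξ := qform_smul _ _ _
  rw [h2] at h1
  obtain ⟨k, hk⟩ := Function.ne_iff.1 hne
  have h3 : 0 < c * ∑ k, ‖ξ k‖ ^ 2 := mul_pos hc <|
    Finset.sum_pos' (fun i _ => sq_nonneg _) ⟨k, Finset.mem_univ _, by
      have := norm_pos_iff.2 hk; positivity⟩
  have h4 := h3.trans_le h1
  exact (mul_pos_iff_of_pos_left (by positivity)).1 h4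

lemma VSpace.transpose_mul (V : VSpace m) : V.Tᵀ * V.T = 1 := mul_eq_one_comm.1 V.orth

lemma framePoint_ne_zero (V : VSpace m) {x : Idx m → ℝ} (hx : x ≠ 0) :
    framePoint V.θ V.T x ≠ 0 := by
  intro h
  have h1 := (smul_eq_zero.1 h).resolve_left (Complex.exp_ne_zero _)
  have h2 := congrArg (· ᵥ* V.Tᵀ) h1
  simp only [Matrix.vecMul_vecMul, V.orth, Matrix.vecMul_one, Matrix.zero_vecMul] at h2
  exact hx (funext fun k => by simpa using congrFun h2 k)

lemma qform_smul_vec {ι : Type*} [Fintype ι] (a : ℂ) (M : Matrix ι ι ℂ) (x : ι → ℂ) :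
    qform M (a • x) = a ^ 2 * qform M x := by
  simp [qform, Matrix.smul_vecMul]; ring

lemma qform_frameMatrix (ħ : ℝ) (V : VSpace m) (K : Matrix (Idx m) (Idx m) ℂ) (x : Idx m → ℝ) :
    qform (frameMatrix ħ V K) (cvec x) =
      Complex.I * qform K (framePoint V.θ V.T x) / (4 * ħ) := by
  rw [frameMatrix, qform_smul, ← qform_vecMul]
  have : framePoint V.θ V.T x = Complex.exp (Complex.I * V.θ) • (cvec x ᵥ* V.T) := rfl
  rw [this, qform_smul_vec]
  ring

lemma PosOn.rePos {ħ : ℝ} (hħ : 0 < ħ) {V : VSpace m} {K : Matrix (Idx m) (Idx m) ℂ}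
    (h : PosOn V K) : RePos (frameMatrix ħ V K) := by
  refine ⟨?_, fun x hx => ?_⟩
  · simp only [frameMatrix, Matrix.IsSymm, Matrix.transpose_smul, Matrix.transpose_mul,
      Matrix.transpose_transpose, h.1.eq, Matrix.mul_assoc]
  · have h1 := h.2 _ ⟨x, rfl⟩ (framePoint_ne_zero V hx)
    rw [qform_frameMatrix]
    have : (4 * (ħ : ℂ)) = ((4 * ħ : ℝ) : ℂ) := by push_cast; rfl
    rw [this, Complex.div_ofReal_re]
    positivity

/-- This is where VJ = V enters: it allows K to be averaged over J without leaving the positive cone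
of V. -/
lemma PosOn.conj_J {V : VSpace m} {K : Matrix (Idx m) (Idx m) ℂ} (h : PosOn V K) :
    PosOn V (Matrix.J (Fin m) ℂ * K * (Matrix.J (Fin m) ℂ)ᵀ) := by
  refine ⟨by
    simp only [Matrix.IsSymm, Matrix.transpose_mul, Matrix.transpose_transpose, h.1.eq,
      Matrix.mul_assoc], fun ξ hξ hne => ?_⟩
  rw [← qform_vecMul]
  refine h.2 _ ?_ fun h0 => hne ?_
  · have := V.J_inv
    unfold VSpace.carrier at hξ ⊢
    rw [← this]
    exact ⟨ξ, hξ, rfl⟩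
  · have h2 := congrArg (· ᵥ* Matrix.J (Fin m) ℂ) h0
    simpa [Matrix.vecMul_vecMul, Matrix.J_squared, Matrix.vecMul_neg] using h2

lemma PosOn.half_add {V : VSpace m} {K L : Matrix (Idx m) (Idx m) ℂ} (h : PosOn V K)
    (h' : PosOn V L) : PosOn V ((1 / 2 : ℂ) • (K + L)) := by
  refine ⟨by simp only [Matrix.IsSymm, Matrix.transpose_add, Matrix.transpose_smul, h.1.eq,
    h'.1.eq], fun ξ hξ hne => ?_⟩
  have h1 := h.2 ξ hξ hne
  have h2 := h'.2 ξ hξ hne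
  rw [qform_smul, qform_add]
  have : Complex.I * (1 / 2 * (qform K ξ + qform L ξ)) =
      ((1 / 2 : ℝ) : ℂ) * (Complex.I * qform K ξ + Complex.I * qform L ξ) := by push_cast; ring
  rw [this, Complex.re_ofReal_mul, Complex.add_re]
  positivity

/-- The mean of `K` over the group generated by `J`. -/
def meanJ (K : Matrix (Idx m) (Idx m) ℂ) : Matrix (Idx m) (Idx m) ℂ :=
  (1 / 2 : ℂ) • (K + Matrix.J (Fin m) ℂ * K * (Matrix.J (Fin m) ℂ)ᵀ)

/-- Conjugation by J exchanges the two summands, since J² = -1 acts trivially by conjugation. -/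
lemma commute_meanJ (K : Matrix (Idx m) (Idx m) ℂ) : Commute (meanJ K) (Matrix.J (Fin m) ℂ) := by
  have hJ := Matrix.J_squared (Fin m) ℂ
  refine Commute.smul_left ?_ _
  show _ * _ = _ * _
  rw [Matrix.J_transpose, Matrix.add_mul, Matrix.mul_add, Matrix.mul_assoc _ (-_), Matrix.neg_mul,
    hJ, neg_neg, Matrix.mul_one]
  have : Matrix.J (Fin m) ℂ * (Matrix.J (Fin m) ℂ * K * -Matrix.J (Fin m) ℂ) =
      (Matrix.J (Fin m) ℂ * Matrix.J (Fin m) ℂ) * K * -Matrix.J (Fin m) ℂ := by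
    simp only [Matrix.mul_assoc]
  rw [this, hJ]
  simp [add_comm]

lemma starDelta_eq (ħ : ℝ) (V : VSpace m) (K : Matrix (Idx m) (Idx m) ℂ) (u : Idx m → ℂ) :
    starDelta ħ V K u = 1 / (2 * Real.pi * ħ : ℂ) ^ m * (Complex.exp (Complex.I * V.θ) ^ (2 * m) *
      gaussInt (frameMatrix ħ V K)
        ((Complex.exp (Complex.I * V.θ) / (Complex.I * ħ)) • (V.T *ᵥ u))) := by
  unfold starDelta gaussInt
  congr 3
  funext x
  rw [starExpLin, qform_frameMatrix]
  congr 1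
  have h1 : framePoint V.θ V.T x ⬝ᵥ u =
      Complex.exp (Complex.I * V.θ) * ((V.T *ᵥ u) ⬝ᵥ cvec x) := by
    rw [dotProduct_comm _ (cvec x), Matrix.dotProduct_mulVec]
    exact smul_dotProduct _ _ _
  rw [h1, smul_dotProduct, smul_eq_mul]
  change 1 / (4 * Complex.I * ħ) * qform K _ + _ = _
  have : 1 / (4 * Complex.I * ħ) = -(Complex.I / (4 * ħ)) := by
    rw [mul_right_comm, one_div, mul_inv, Complex.inv_I]
    ring
  rw [this]
  ring

lemma starDelta_zero (ħ : ℝ) (V : VSpace m) (K : Matrix (Idx m) (Idx m) ℂ) :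
    starDelta ħ V K 0 = 1 / (2 * Real.pi * ħ : ℂ) ^ m *
      (Complex.exp (Complex.I * V.θ) ^ (2 * m) * gaussInt (frameMatrix ħ V K) 0) := by
  simp [starDelta_eq]

lemma frameMatrix_inv {ħ : ℝ} (hħ : 0 < ħ) (V : VSpace m) {K : Matrix (Idx m) (Idx m) ℂ}
    (hK : K.det ≠ 0) : (frameMatrix ħ V K)⁻¹ =
      (Complex.I * Complex.exp (Complex.I * V.θ) ^ 2 / (4 * ħ))⁻¹ • (V.T * K⁻¹ * V.Tᵀ) := by
  have hne : Complex.I * Complex.exp (Complex.I * V.θ) ^ 2 / (4 * ħ) ≠ 0 := by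
    have : (ħ : ℂ) ≠ 0 := by exact_mod_cast hħ.ne'
    simp [Complex.exp_ne_zero, this]
  apply Matrix.inv_eq_right_inv
  rw [frameMatrix, Matrix.smul_mul, Matrix.mul_smul, smul_smul, mul_inv_cancel₀ hne, one_smul]
  calc V.T * K * V.Tᵀ * (V.T * K⁻¹ * V.Tᵀ) = V.T * (K * (V.Tᵀ * V.T) * K⁻¹) * V.Tᵀ := by
        simp only [Matrix.mul_assoc]
    _ = 1 := by
      rw [V.transpose_mul, Matrix.mul_one, Matrix.mul_nonsing_inv _ (isUnit_iff_ne_zero.2 hK),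
        Matrix.mul_one, V.orth]

lemma det_frameMatrix (ħ : ℝ) (V : VSpace m) (K : Matrix (Idx m) (Idx m) ℂ) :
    (frameMatrix ħ V K).det =
      (Complex.I * Complex.exp (Complex.I * V.θ) ^ 2 / (4 * ħ)) ^ (2 * m) * K.det := by
  rw [frameMatrix, Matrix.det_smul, Matrix.det_mul, Matrix.det_mul, mul_right_comm V.T.det,
    ← Matrix.det_mul, V.orth, Matrix.det_one, one_mul, Fintype.card_sum, Fintype.card_fin, two_mul]

lemma PosOn.det_ne_zero {V : VSpace m} {K : Matrix (Idx m) (Idx m) ℂ} (h : PosOn V K) :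
    K.det ≠ 0 := by
  intro h0
  apply (h.rePos one_pos).det_ne_zero
  rw [det_frameMatrix, h0, mul_zero]

/-- The frame drops out of the exponent: T is orthogonal, and the phase e^{2iθ} of the linear term
squared cancels the one in the inverse of the quadratic form. -/
lemma PosOn.starDelta_eq_mul_exp {ħ : ℝ} (hħ : 0 < ħ) {V : VSpace m}
    {K : Matrix (Idx m) (Idx m) ℂ} (h : PosOn V K) (u : Idx m → ℂ) :
    starDelta ħ V K u =
      starDelta ħ V K 0 * Complex.exp (-(1 / (Complex.I * ħ)) * qform K⁻¹ u) := by
  rw [starDelta_eq, starDelta_zero, (h.rePos hħ).gaussInt_eq_mul_exp,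
    frameMatrix_inv hħ V h.det_ne_zero, qform_smul, qform_smul_vec]
  have h1 : qform (V.T * K⁻¹ * V.Tᵀ) (V.T *ᵥ u) = qform K⁻¹ u := by
    rw [← Matrix.vecMul_transpose, qform_vecMul, Matrix.transpose_transpose]
    congr 1
    calc V.Tᵀ * (V.T * K⁻¹ * V.Tᵀ) * V.T = (V.Tᵀ * V.T) * K⁻¹ * (V.Tᵀ * V.T) := by
          simp only [Matrix.mul_assoc]
      _ = _ := by rw [V.transpose_mul, Matrix.one_mul, Matrix.mul_one]
  rw [h1]
  have hne : (ħ : ℂ) ≠ 0 := by exact_mod_cast hħ.ne'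
  have hE := Complex.exp_ne_zero (Complex.I * V.θ)
  have h2 : (Complex.I * Complex.exp (Complex.I * V.θ) ^ 2 / (4 * ħ))⁻¹ *
      ((Complex.exp (Complex.I * V.θ) / (Complex.I * ħ)) ^ 2 * qform K⁻¹ u) / 4 =
      -(1 / (Complex.I * ħ)) * qform K⁻¹ u := by
    have hI := Complex.I_sq
    have hI0 := Complex.I_ne_zero
    field_simp
    rw [hI]
    ring
  rw [h2]
  ring

/-- The phase in the volume element cancels the phase of the frame matrix, leaving (2/i)² = -4 for
each of the m pairs of coordinates. -/
lemma PosOn.starDelta_zero_sq {ħ : ℝ} (hħ : 0 < ħ) {V : VSpace m}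
    {K : Matrix (Idx m) (Idx m) ℂ} (h : PosOn V K) :
    starDelta ħ V K 0 ^ 2 * K.det = (-4) ^ m := by
  have h1 := (h.rePos hħ).gaussInt_sq
  have hne : (ħ : ℂ) ≠ 0 := by exact_mod_cast hħ.ne'
  have hE := Complex.exp_ne_zero (Complex.I * V.θ)
  have hpi : (Real.pi : ℂ) ≠ 0 := by simp
  have hI0 := Complex.I_ne_zero
  rw [det_frameMatrix, Fintype.card_sum, Fintype.card_fin, ← two_mul] at h1
  rw [starDelta_zero]
  set G := gaussInt (frameMatrix ħ V K) 0
  set E := Complex.exp (Complex.I * V.θ)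
  have h2 : G ^ 2 * K.det = (Real.pi : ℂ) ^ (2 * m) / (Complex.I * E ^ 2 / (4 * ħ)) ^ (2 * m) := by
    rw [← h1]; field_simp
  calc (1 / (2 * Real.pi * ħ : ℂ) ^ m * (E ^ (2 * m) * G)) ^ 2 * K.det
      = (1 / (2 * Real.pi * ħ : ℂ) ^ m * E ^ (2 * m)) ^ 2 * (G ^ 2 * K.det) := by ring
    _ = ((1 / (2 * Real.pi * ħ : ℂ) * E ^ 2) ^ 2 *
          (Real.pi / (Complex.I * E ^ 2 / (4 * ħ))) ^ 2) ^ m := by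
        rw [h2, ← div_pow, pow_mul E, ← _root_.one_div_pow, ← mul_pow, mul_pow (_ ^ 2), ← pow_mul,
          ← pow_mul, ← pow_mul, mul_comm m 2]
    _ = (-4) ^ m := by
        congr 1
        have hI := Complex.I_sq
        field_simp
        rw [hI]; ring

/-- In the frame of V the complex structure becomes N = TJᵗT, and the determinant on its eigenspace
is that of J up to the scalar a^m. The factor e^{2imθ} in a^m cancels the volume phase, so no trace
of V remains and the sign of the delta function at the averaged K is known. -/
lemma PosOn.starDelta_meanJ {ħ : ℝ} (hħ : 0 < ħ) {V : VSpace m}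
    {K : Matrix (Idx m) (Idx m) ℂ} (h : PosOn V K) :
    starDelta ħ V (meanJ K) 0 * eigenDet (Matrix.J (Fin m) ℂ) (meanJ K) =
      (2 / Complex.I) ^ m := by
  have hp : PosOn V (meanJ K) := h.half_add h.conj_J
  have hne : (ħ : ℂ) ≠ 0 := by exact_mod_cast hħ.ne'
  have hE := Complex.exp_ne_zero (Complex.I * V.θ)
  have hpi : (Real.pi : ℂ) ≠ 0 := by simp
  have hI0 := Complex.I_ne_zero
  have hJ := Matrix.J_squared (Fin m) ℂ
  have hJt := Matrix.J_transpose (Fin m) ℂ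
  have hcomm := commute_meanJ K
  set N := V.T * Matrix.J (Fin m) ℂ * V.Tᵀ with hN
  have conj_mul : ∀ A B : Matrix (Idx m) (Idx m) ℂ,
      V.T * A * V.Tᵀ * (V.T * B * V.Tᵀ) = V.T * (A * B) * V.Tᵀ := by
    intro A B
    calc V.T * A * V.Tᵀ * (V.T * B * V.Tᵀ) = V.T * (A * (V.Tᵀ * V.T) * B) * V.Tᵀ := by
          simp only [Matrix.mul_assoc]
      _ = _ := by rw [V.transpose_mul, Matrix.mul_one]
  have hNN : N * N = -1 := by
    rw [hN, conj_mul, hJ, Matrix.mul_neg, Matrix.neg_mul, Matrix.mul_one, V.orth]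
  have hNt : Nᵀ = -N := by
    rw [hN]
    simp only [Matrix.transpose_mul, Matrix.transpose_transpose, hJt, Matrix.neg_mul,
      Matrix.mul_neg, Matrix.mul_assoc]
  set a := Complex.I * Complex.exp (Complex.I * V.θ) ^ 2 / (4 * ħ) with ha
  have hF : frameMatrix ħ V (meanJ K) = V.T * ((a • 1) * meanJ K) * V.Tᵀ := by
    rw [frameMatrix, Matrix.smul_mul, Matrix.one_mul, Matrix.mul_smul, Matrix.smul_mul]
  have hc : Commute (frameMatrix ħ V (meanJ K)) N := by
    rw [hF]
    show _ * _ = _ * _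
    rw [hN, conj_mul, conj_mul, Matrix.smul_mul, Matrix.one_mul, Matrix.smul_mul,
      Matrix.mul_smul (Matrix.J (Fin m) ℂ), hcomm.eq]
  have key := (hp.rePos hħ).gaussInt_mul_eigenDet hNN hNt hc
  have hd : eigenDet N (frameMatrix ħ V (meanJ K)) =
      a ^ m * eigenDet (Matrix.J (Fin m) ℂ) (meanJ K) := by
    rw [hF, hN, eigenDet_conj V.orth, eigenDet_mul hJ hcomm, eigenDet_J_smul]
  rw [hd] at key
  rw [starDelta_zero]
  set G := gaussInt (frameMatrix ħ V (meanJ K)) 0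
  set E := Complex.exp (Complex.I * V.θ)
  set δ := eigenDet (Matrix.J (Fin m) ℂ) (meanJ K)
  have ha0 : a ≠ 0 := by simp [ha, hE, hne]
  have h2 : G * δ = (Real.pi / a) ^ m := by
    rw [div_pow, ← key]; field_simp
  calc 1 / (2 * Real.pi * ħ : ℂ) ^ m * (E ^ (2 * m) * G) * δ
      = 1 / (2 * Real.pi * ħ : ℂ) ^ m * E ^ (2 * m) * (G * δ) := by ring
    _ = (1 / (2 * Real.pi * ħ : ℂ) * E ^ 2 * (Real.pi / a)) ^ m := by
        rw [h2, pow_mul E, ← _root_.one_div_pow, ← mul_pow, ← mul_pow]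
    _ = (2 / Complex.I) ^ m := by
        congr 1
        rw [ha]
        field_simp
        ring

lemma frameMatrix_combo (ħ : ℝ) (V : VSpace m) (K L : Matrix (Idx m) (Idx m) ℂ) (a b : ℂ) :
    frameMatrix ħ V (a • K + b • L) = a • frameMatrix ħ V K + b • frameMatrix ħ V L := by
  simp only [frameMatrix, Matrix.mul_add, Matrix.add_mul, Matrix.mul_smul, Matrix.smul_mul,
    smul_add, smul_comm a, smul_comm b]

lemma PosOn.combo {V : VSpace m} {K L : Matrix (Idx m) (Idx m) ℂ} (h : PosOn V K)
    (h' : PosOn V L) {t : ℝ} (ht : t ∈ Set.Icc (0 : ℝ) 1) :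
    PosOn V ((1 - t : ℂ) • K + (t : ℂ) • L) := by
  refine ⟨by simp only [Matrix.IsSymm, Matrix.transpose_add, Matrix.transpose_smul, h.1.eq,
    h'.1.eq], fun ξ hξ hne => ?_⟩
  have h1 := h.2 ξ hξ hne
  have h2 := h'.2 ξ hξ hne
  have : Complex.I * ((1 - t) * qform K ξ + t * qform L ξ) =
      ((1 - t : ℝ) : ℂ) * (Complex.I * qform K ξ) + (t : ℂ) * (Complex.I * qform L ξ) := by
    push_cast; ring
  rw [qform_add, qform_smul, qform_smul, this, Complex.add_re, Complex.re_ofReal_mul,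
    Complex.re_ofReal_mul]
  rcases ht.1.eq_or_lt with h0 | h0
  · rw [← h0]; simpa using h1
  · nlinarith [mul_pos h0 h2, mul_nonneg (sub_nonneg.2 ht.2) h1.le]

lemma PosOn.starDelta_zero_ne_zero {ħ : ℝ} (hħ : 0 < ħ) {V : VSpace m}
    {K : Matrix (Idx m) (Idx m) ℂ} (h : PosOn V K) : starDelta ħ V K 0 ≠ 0 := by
  intro h0
  have := h.starDelta_zero_sq hħ
  rw [h0] at this
  exact pow_ne_zero m (by norm_num : (-4 : ℂ) ≠ 0) (by rw [← this]; ring)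

/-- The delta function does not depend on the real subspace on which it is an integral. -/
lemma PosOn.starDelta_zero_eq {ħ : ℝ} (hħ : 0 < ħ) {V W : VSpace m}
    {K : Matrix (Idx m) (Idx m) ℂ} (hV : PosOn V K) (hW : PosOn W K) :
    starDelta ħ V K 0 = starDelta ħ W K 0 := by
  have mean : ∀ {U : VSpace m}, PosOn U K → PosOn U (meanJ K) := fun h => h.half_add h.conj_J
  have cont : ∀ {U : VSpace m}, PosOn U K → ContinuousOn
      (fun t : ℝ => starDelta ħ U ((1 - t : ℂ) • meanJ K + (t : ℂ) • K) 0) (Set.Icc 0 1) := by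
    intro U h
    simp only [starDelta_zero, frameMatrix_combo]
    have := ((mean h).rePos hħ).continuousOn_gaussInt_combo (h.rePos hħ)
    fun_prop
  -- The segment from the average to K lies in both positive cones. The two values have equal
  -- nonzero squares along it and agree at its start, where both are determined by `eigenDet`.
  have key := (isPreconnected_Icc (a := (0 : ℝ)) (b := 1)).eq_of_sq_eq (y := 0)
    (cont hV) (cont hW) ?_
    (fun {t} ht => ((mean hW).combo hW ht).starDelta_zero_ne_zero hħ) (by simp) ?_
  · simpa using key (x := 1) (by simp)
  · intro t ht
    have h1 := ((mean hV).combo hV ht).starDelta_zero_sq hħ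
    have h2 := ((mean hW).combo hW ht).starDelta_zero_sq hħ
    exact mul_right_cancel₀ ((mean hV).combo hV ht).det_ne_zero (h1.trans h2.symm)
  · have h1 := hV.starDelta_meanJ hħ
    have h2 := hW.starDelta_meanJ hħ
    have hne : eigenDet (Matrix.J (Fin m) ℂ) (meanJ K) ≠ 0 := by
      intro h0
      have := eigenDet_sq (Matrix.J_squared (Fin m) ℂ) (Matrix.J_transpose (Fin m) ℂ)
        (mean hV).1 (commute_meanJ K)
      rw [h0] at this
      exact (mean hV).det_ne_zero (by rw [← this]; ring)
    simpa using mul_right_cancel₀ hne (h1.trans h2.symm)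

end Delta

/-! ### Star products with polynomials of degree at most two -/

section StarProduct

variable {m : ℕ}

/-- The bilinear form `u A ᵗv`. -/
def bform {ι : Type*} [Fintype ι] (A : Matrix ι ι ℂ) : (ι → ℂ) →L[ℂ] (ι → ℂ) →L[ℂ] ℂ :=
  (LinearMap.mk₂ ℂ (fun u v => (u ᵥ* A) ⬝ᵥ v) (fun u u' v => by simp [Matrix.add_vecMul])
    (fun a u v => by simp [Matrix.smul_vecMul]) (fun u v v' => by simp)
    (fun a u v => by simp)).toContinuousBilinearMap

lemma bform_apply {ι : Type*} [Fintype ι] (A : Matrix ι ι ℂ) (u v : ι → ℂ) :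
    bform A u v = (u ᵥ* A) ⬝ᵥ v := rfl

lemma bform_comm {ι : Type*} [Fintype ι] {A : Matrix ι ι ℂ} (hA : A.IsSymm) (u v : ι → ℂ) :
    bform A u v = bform A v u := by
  rw [bform_apply, bform_apply, dotProduct_comm, ← Matrix.mulVec_transpose, hA.eq,
    Matrix.dotProduct_mulVec]

lemma hasFDerivAt_qform {ι : Type*} [Fintype ι] {A : Matrix ι ι ℂ} (hA : A.IsSymm) (u : ι → ℂ) :
    HasFDerivAt (qform A) ((2 : ℂ) • bform A u) u := by
  have h : HasFDerivAt (fun v => bform A v v) _ u :=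
    (bform A).hasFDerivAt.clm_apply (hasFDerivAt_id u)
  refine h.congr_fderiv ?_
  ext1 v
  simp [bform_comm hA v u, two_mul]

lemma iteratedFDeriv_eq_zero_of_le {E F : Type*} [NormedAddCommGroup E] [NormedSpace ℂ E]
    [NormedAddCommGroup F] [NormedSpace ℂ F] {f : E → F} {n k : ℕ} (hnk : n ≤ k)
    (h : iteratedFDeriv ℂ n f = 0) : iteratedFDeriv ℂ k f = 0 := by
  induction k, hnk using Nat.le_induction with
  | base => exact h
  | succ k _ ih =>
    ext u v
    rw [iteratedFDeriv_succ_apply_left, ih]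
    simp

lemma iteratedFDeriv_succ_eq_zero {E F : Type*} [NormedAddCommGroup E] [NormedSpace ℂ E]
    [NormedAddCommGroup F] [NormedSpace ℂ F] {f : E → F} {n : ℕ}
    (h : ∀ u, iteratedFDeriv ℂ n f u = iteratedFDeriv ℂ n f 0) :
    iteratedFDeriv ℂ (n + 1) f = 0 := by
  ext u v
  rw [iteratedFDeriv_succ_apply_left, funext h]
  simp

lemma partialD_zero (i : Fin 0 → Idx m) (f : (Idx m → ℂ) → ℂ) (u : Idx m → ℂ) :
    partialD i f u = f u := by simp [partialD]

lemma partialD_one (i : Fin 1 → Idx m) (f : (Idx m → ℂ) → ℂ) (u : Idx m → ℂ) :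
    partialD i f u = fderiv ℂ f u (Pi.single (i 0) 1) := by simp [partialD]

lemma partialD_two (i : Fin 2 → Idx m) (f : (Idx m → ℂ) → ℂ) (u : Idx m → ℂ) :
    partialD i f u = fderiv ℂ (fderiv ℂ f) u (Pi.single (i 0) 1) (Pi.single (i 1) 1) := by
  simp [partialD, iteratedFDeriv_two_apply]

/-- A vanishing n-th derivative cuts the series off, so no convergence question arises for the other
factor. -/
lemma starMul_eq_sum_range (ħ : ℝ) (K : Matrix (Idx m) (Idx m) ℂ) {f : (Idx m → ℂ) → ℂ}
    {n : ℕ} (hf : iteratedFDeriv ℂ n f = 0) (h : (Idx m → ℂ) → ℂ) (u : Idx m → ℂ) :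
    starMul ħ K f h u = ∑ k ∈ Finset.range n,
      (Complex.I * ħ) ^ k / ((k.factorial : ℂ) * 2 ^ k) *
        ∑ i : Fin k → Idx m, ∑ j : Fin k → Idx m,
          (∏ a, (K + Matrix.J (Fin m) ℂ) (i a) (j a)) * partialD i f u * partialD j h u := by
  refine tsum_eq_sum fun k hk => ?_
  have := iteratedFDeriv_eq_zero_of_le (not_lt.1 fun h => hk (Finset.mem_range.2 h)) hf
  simp [partialD, this]

lemma sum_fin_one {M : Type*} [AddCommMonoid M] (φ : (Fin 1 → Idx m) → M) :
    ∑ i, φ i = ∑ i, φ ![i] := by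
  rw [← (Equiv.funUnique (Fin 1) (Idx m)).symm.sum_comp]
  refine Finset.sum_congr rfl fun i _ => congrArg φ ?_
  ext a; fin_cases a; rfl

lemma sum_fin_two {M : Type*} [AddCommMonoid M] (φ : (Fin 2 → Idx m) → M) :
    ∑ i, φ i = ∑ i, ∑ j, φ ![i, j] := by
  rw [← (finTwoArrowEquiv (Idx m)).symm.sum_comp, Fintype.sum_prod_type]
  rfl

lemma sum_comm_pairs {κ M : Type*} [Fintype κ] [AddCommMonoid M] (φ : κ → κ → κ → κ → M) :
    ∑ a, ∑ b, ∑ c, ∑ d, φ a b c d = ∑ c, ∑ d, ∑ a, ∑ b, φ a b c d := by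
  have := Finset.sum_comm (s := (Finset.univ : Finset (κ × κ)))
    (t := (Finset.univ : Finset (κ × κ))) (f := fun p q => φ p.1 p.2 q.1 q.2)
  simpa only [Fintype.sum_prod_type] using this

/-- The `*_K`-product with a function of the first degree. -/
lemma starMul_linear (ħ : ℝ) (K : Matrix (Idx m) (Idx m) ℂ) (l : (Idx m → ℂ) →L[ℂ] ℂ)
    (h : (Idx m → ℂ) → ℂ) (u : Idx m → ℂ) :
    starMul ħ K l h u = l u * h u + Complex.I * ħ / 2 *
      ∑ i, ∑ j, (K + Matrix.J (Fin m) ℂ) i j * l (Pi.single i 1) *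
        fderiv ℂ h u (Pi.single j 1) := by
  have h2 : iteratedFDeriv ℂ 2 l = 0 := by
    refine iteratedFDeriv_succ_eq_zero (n := 1) fun v => ?_
    ext w
    simp
  rw [starMul_eq_sum_range ħ K h2]
  simp only [Finset.sum_range_succ, Finset.sum_range_zero, sum_fin_one, partialD_one]
  simp [partialD_zero]

lemma fderiv_quadratic {A : Matrix (Idx m) (Idx m) ℂ} (hA : A.IsSymm) (α β : ℂ) :
    fderiv ℂ (fun u => α * qform A u + β) = fun u => ((2 * α) • bform A) u := by
  funext u
  rw [(((hasFDerivAt_qform hA u).const_mul α).add_const β).fderiv, smul_smul, mul_comm]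
  rfl

lemma fderiv_fderiv_quadratic {A : Matrix (Idx m) (Idx m) ℂ} (hA : A.IsSymm) (α β : ℂ)
    (u : Idx m → ℂ) :
    fderiv ℂ (fderiv ℂ (fun u => α * qform A u + β)) u = (2 * α) • bform A := by
  rw [fderiv_quadratic hA]
  exact ContinuousLinearMap.fderiv _

/-- The second order differential operator with coefficients `h`, `b` and `C`. -/
def diffOp (h : (Idx m → ℂ) → ℂ) (b : Idx m → (Idx m → ℂ) → ℂ) (C : Matrix (Idx m) (Idx m) ℂ)
    (f : (Idx m → ℂ) → ℂ) (u : Idx m → ℂ) : ℂ :=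
  h u * f u + ∑ j, b j u * fderiv ℂ f u (Pi.single j 1) +
    ∑ j, ∑ k, C j k * fderiv ℂ (fderiv ℂ f) u (Pi.single j 1) (Pi.single k 1)

lemma bform_single_right {ι : Type*} [Fintype ι] [DecidableEq ι] (A : Matrix ι ι ℂ) (u : ι → ℂ)
    (j : ι) : bform A u (Pi.single j 1) = (u ᵥ* A) j := by
  simp [bform_apply]

lemma bform_single_single {ι : Type*} [Fintype ι] [DecidableEq ι] (A : Matrix ι ι ℂ) (i j : ι) :
    bform A (Pi.single i 1) (Pi.single j 1) = A i j := by
  simp [bform_apply]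

/-- The `*_K`-product with a function of the second degree. -/
lemma starMul_quadratic (ħ : ℝ) (K : Matrix (Idx m) (Idx m) ℂ) {A : Matrix (Idx m) (Idx m) ℂ}
    (hA : A.IsSymm) (α β : ℂ) (f : (Idx m → ℂ) → ℂ) :
    starMul ħ K (fun u => α * qform A u + β) f =
      diffOp (fun u => α * qform A u + β)
        (fun j u => Complex.I * ħ * α * (u ᵥ* (A * (K + Matrix.J (Fin m) ℂ))) j)
        (((Complex.I * ħ) ^ 2 * α / 4) •
          ((K + Matrix.J (Fin m) ℂ)ᵀ * A * (K + Matrix.J (Fin m) ℂ))) f := by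
  funext u
  have h3 : iteratedFDeriv ℂ 3 (fun u => α * qform A u + β) = 0 := by
    refine iteratedFDeriv_succ_eq_zero (n := 2) fun v => ?_
    ext w
    rw [iteratedFDeriv_two_apply, iteratedFDeriv_two_apply, fderiv_fderiv_quadratic hA,
      fderiv_fderiv_quadratic hA]
  set Λ := K + Matrix.J (Fin m) ℂ with hΛ
  rw [starMul_eq_sum_range ħ K h3]
  simp only [Finset.sum_range_succ, Finset.sum_range_zero, sum_fin_one, sum_fin_two, partialD_one,
    partialD_two, fderiv_fderiv_quadratic hA, ← hΛ]
  rw [fderiv_quadratic hA]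
  simp only [diffOp, partialD_zero, _root_.smul_apply, bform_single_right, smul_eq_mul]
  congr 1
  · congr 1
    · simp
    · simp only [Finset.mul_sum]
      rw [Finset.sum_comm]
      refine Finset.sum_congr rfl fun j _ => ?_
      rw [← Matrix.vecMul_vecMul]
      simp only [vecMul, dotProduct, Finset.mul_sum, Finset.sum_mul]
      refine Finset.sum_congr rfl fun i _ => Finset.sum_congr rfl fun k _ => ?_
      simp
      ring
  · simp only [Finset.mul_sum, Matrix.smul_apply, Matrix.mul_apply, Finset.sum_mul,
      Matrix.transpose_apply, smul_eq_mul]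
    rw [Finset.sum_comm]
    simp only [Fin.prod_univ_two]
    rw [sum_comm_pairs]
    refine Finset.sum_congr rfl fun j _ => Finset.sum_congr rfl fun k _ =>
      Finset.sum_congr rfl fun i _ => Finset.sum_congr rfl fun l _ => ?_
    have : (Pi.single l (1 : ℂ) ᵥ* A) i = A l i := by simp
    simp [this]
    ring

/-- The first order terms add up to the trace of ᵗg(K + J)g, in which the antisymmetric J does not
contribute; the prefactors (1/2iħ)(iħ/2) give 1/4. -/
lemma quadHam_eq {ħ : ℝ} (hħ : 0 < ħ) {K g : Matrix (Idx m) (Idx m) ℂ} :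
    quadHam ħ K g = fun u => 1 / (2 * Complex.I * ħ) * qform (g * gᵀ) u +
      (gᵀ * K * g).trace / 4 := by
  funext u
  have hne : (ħ : ℂ) ≠ 0 := by exact_mod_cast hħ.ne'
  have hI0 := Complex.I_ne_zero
  let l : Idx m → (Idx m → ℂ) →L[ℂ] ℂ := fun k =>
    LinearMap.toContinuousLinearMap ((LinearMap.proj k).comp (Matrix.vecMulLinear g))
  have hl : ∀ k, (fun v : Idx m → ℂ => (v ᵥ* g) k) = l k := fun k => rfl
  have h1 : ∀ k, l k u = (u ᵥ* g) k := fun k => rfl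
  have h2 : ∀ k i, l k (Pi.single i 1) = g i k := fun k i => by
    rw [← hl]; simp
  have h3 : ∑ k, (u ᵥ* g) k * (u ᵥ* g) k = qform (g * gᵀ) u := by
    have := qform_vecMul 1 g u
    rw [Matrix.mul_one] at this
    rw [← this]
    simp [qform, dotProduct]
  have h4 : (gᵀ * Matrix.J (Fin m) ℂ * g).trace = 0 := by
    have h := Matrix.trace_transpose (gᵀ * Matrix.J (Fin m) ℂ * g)
    simp only [Matrix.transpose_mul, Matrix.transpose_transpose, Matrix.J_transpose,
      Matrix.neg_mul, Matrix.mul_neg, Matrix.trace_neg, ← Matrix.mul_assoc] at h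
    exact self_eq_neg.1 h.symm
  have h5 : ∑ k, ∑ i, ∑ j, (K + Matrix.J (Fin m) ℂ) i j * g i k * g j k =
      (gᵀ * K * g).trace := by
    have : (gᵀ * (K + Matrix.J (Fin m) ℂ) * g).trace = (gᵀ * K * g).trace := by
      rw [Matrix.mul_add, Matrix.add_mul, Matrix.trace_add, h4, add_zero]
    rw [← this]
    simp only [Matrix.trace, Matrix.diag_apply, Matrix.mul_apply, Matrix.transpose_apply,
      Finset.sum_mul]
    refine Finset.sum_congr rfl fun k _ => ?_
    rw [Finset.sum_comm]
    exact Finset.sum_congr rfl fun i _ => Finset.sum_congr rfl fun j _ => by ring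
  simp only [quadHam, hl, starMul_linear, ContinuousLinearMap.fderiv, h1, h2]
  rw [Finset.sum_add_distrib, h3, ← Finset.mul_sum, h5]
  field_simp
  ring

end StarProduct

/-! ### Uniqueness of the continuation along a path -/

section Uniqueness

variable {m : ℕ}

/-- The derivative in the direction `v` of a function of time and space. -/
def dirDeriv (v : ℂ × (Idx m → ℂ)) (Ψ : ℂ × (Idx m → ℂ) → ℂ) : ℂ × (Idx m → ℂ) → ℂ :=
  fun p => fderiv ℂ Ψ p v

lemma analyticAt_dirDeriv {Ψ : ℂ × (Idx m → ℂ) → ℂ} {p : ℂ × (Idx m → ℂ)}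
    (h : AnalyticAt ℂ Ψ p) (v : ℂ × (Idx m → ℂ)) : AnalyticAt ℂ (dirDeriv v Ψ) p :=
  ((ContinuousLinearMap.apply ℂ ℂ v).analyticAt _).comp h.fderiv

lemma dirDeriv_comm {Ψ : ℂ × (Idx m → ℂ) → ℂ} {p : ℂ × (Idx m → ℂ)} (h : AnalyticAt ℂ Ψ p)
    (v w : ℂ × (Idx m → ℂ)) : dirDeriv v (dirDeriv w Ψ) p = dirDeriv w (dirDeriv v Ψ) p := by
  have hd : DifferentiableAt ℂ (fderiv ℂ Ψ) p := h.fderiv.differentiableAt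
  have key : ∀ a b : ℂ × (Idx m → ℂ), dirDeriv a (dirDeriv b Ψ) p = fderiv ℂ (fderiv ℂ Ψ) p a b := by
    intro a b
    have : HasFDerivAt (fun q => fderiv ℂ Ψ q b) _ p :=
      hd.hasFDerivAt.clm_apply (hasFDerivAt_const b p)
    unfold dirDeriv
    rw [this.fderiv]
    simp
  rw [key, key]
  have hs : IsSymmSndFDerivAt ℂ Ψ p := (h.contDiffAt (n := 2)).isSymmSndFDerivAt (by simp)
  exact hs v w

lemma dirDeriv_congr {Ψ Θ : ℂ × (Idx m → ℂ) → ℂ} {Ω : Set (ℂ × (Idx m → ℂ))} (hΩ : IsOpen Ω)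
    (h : Set.EqOn Ψ Θ Ω) (v : ℂ × (Idx m → ℂ)) : Set.EqOn (dirDeriv v Ψ) (dirDeriv v Θ) Ω := by
  intro p hp
  unfold dirDeriv
  rw [(h.eventuallyEq_of_mem (hΩ.mem_nhds hp)).fderiv_eq]

/-- The operator `diffOp` acting on functions of time and space. -/
def diffOpTime (h : (Idx m → ℂ) → ℂ) (b : Idx m → (Idx m → ℂ) → ℂ)
    (C : Matrix (Idx m) (Idx m) ℂ) (Ψ : ℂ × (Idx m → ℂ) → ℂ) (p : ℂ × (Idx m → ℂ)) : ℂ :=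
  h p.2 * Ψ p + ∑ j, b j p.2 * dirDeriv (0, Pi.single j 1) Ψ p +
    ∑ j, ∑ k, C j k * dirDeriv (0, Pi.single j 1) (dirDeriv (0, Pi.single k 1) Ψ) p

lemma fderiv_slice {Ψ : ℂ × (Idx m → ℂ) → ℂ} {t : ℂ} {u : Idx m → ℂ}
    (h : AnalyticAt ℂ Ψ (t, u)) (e : Idx m → ℂ) :
    fderiv ℂ (fun u => Ψ (t, u)) u e = dirDeriv (0, e) Ψ (t, u) := by
  have : HasFDerivAt (fun u => Ψ (t, u)) _ u :=
    h.differentiableAt.hasFDerivAt.comp u (hasFDerivAt_prodMk_right t u)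
  rw [this.fderiv]
  simp [dirDeriv]

/-- Passing to derivatives in the joint variable (t, u) makes symmetry of second derivatives
available for exchanging ∂ₜ with the operator. -/
lemma diffOp_slice {B : Set ℂ} {Ψ : ℂ × (Idx m → ℂ) → ℂ}
    (h : AnalyticOnNhd ℂ Ψ (B ×ˢ Set.univ)) {t : ℂ} (ht : t ∈ B) (H : (Idx m → ℂ) → ℂ)
    (b : Idx m → (Idx m → ℂ) → ℂ) (C : Matrix (Idx m) (Idx m) ℂ) (u : Idx m → ℂ) :
    diffOp H b C (fun u => Ψ (t, u)) u = diffOpTime H b C Ψ (t, u) := by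
  have hA : ∀ u, AnalyticAt ℂ Ψ (t, u) := fun u => h _ ⟨ht, trivial⟩
  have h2 : ∀ e e' : Idx m → ℂ, fderiv ℂ (fderiv ℂ (fun u => Ψ (t, u))) u e e' =
      dirDeriv (0, e) (dirDeriv (0, e') Ψ) (t, u) := by
    intro e e'
    have hs : AnalyticAt ℂ (fun u => Ψ (t, u)) u :=
      (hA u).comp (f := fun u => (t, u)) (analyticAt_const.prod analyticAt_id)
    have h3 : HasFDerivAt (fun v => fderiv ℂ (fun u => Ψ (t, u)) v e') _ u :=
      hs.fderiv.differentiableAt.hasFDerivAt.clm_apply (hasFDerivAt_const e' u)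
    have h4 : fderiv ℂ (fun v => fderiv ℂ (fun u => Ψ (t, u)) v e') u e =
        fderiv ℂ (fderiv ℂ (fun u => Ψ (t, u))) u e e' := by
      rw [h3.fderiv]; simp
    rw [← h4]
    simp only [fderiv_slice (hA _)]
    exact fderiv_slice (analyticAt_dirDeriv (hA u) _) e
  simp only [diffOp, diffOpTime, h2, fderiv_slice (hA u)]

/-- The coefficients do not depend on t and mixed derivatives commute; hence the t-derivative of a
solution is again a solution. -/
lemma dirDeriv_diffOpTime {B : Set ℂ} (hB : IsOpen B) {Ψ : ℂ × (Idx m → ℂ) → ℂ}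
    (h : AnalyticOnNhd ℂ Ψ (B ×ˢ Set.univ)) {H : (Idx m → ℂ) → ℂ} (hH : Differentiable ℂ H)
    {b : Idx m → (Idx m → ℂ) → ℂ} (hb : ∀ j, Differentiable ℂ (b j))
    (C : Matrix (Idx m) (Idx m) ℂ) :
    Set.EqOn (dirDeriv (1, 0) (diffOpTime H b C Ψ)) (diffOpTime H b C (dirDeriv (1, 0) Ψ))
      (B ×ˢ Set.univ) := by
  intro p hp
  have hΩ : IsOpen (B ×ˢ (Set.univ : Set (Idx m → ℂ))) := hB.prod isOpen_univ
  have hcoef : ∀ {c : (Idx m → ℂ) → ℂ} {Θ : ℂ × (Idx m → ℂ) → ℂ}, Differentiable ℂ c →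
      AnalyticAt ℂ Θ p → ∃ L : ℂ × (Idx m → ℂ) →L[ℂ] ℂ, HasFDerivAt (fun q : ℂ × (Idx m → ℂ) => c q.2 * Θ q) L p ∧
        L (1, 0) = c p.2 * dirDeriv (1, 0) Θ p := by
    intro c Θ hc hΘ
    have h1 : HasFDerivAt (fun q : ℂ × (Idx m → ℂ) => c q.2) _ p :=
      (hc p.2).hasFDerivAt.comp p hasFDerivAt_snd
    exact ⟨_, h1.mul hΘ.differentiableAt.hasFDerivAt, by simp [dirDeriv]⟩
  have hsum : ∀ {ι : Type} [Fintype ι] {φ : ι → ℂ × (Idx m → ℂ) → ℂ} {v : ι → ℂ},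
      (∀ i, ∃ L : ℂ × (Idx m → ℂ) →L[ℂ] ℂ, HasFDerivAt (φ i) L p ∧ L (1, 0) = v i) →
      ∃ L : ℂ × (Idx m → ℂ) →L[ℂ] ℂ, HasFDerivAt (fun q => ∑ i, φ i q) L p ∧ L (1, 0) = ∑ i, v i := by
    intro ι _ φ v hφ
    choose L hL hLv using hφ
    exact ⟨∑ i, L i, HasFDerivAt.fun_sum fun i _ => hL i, by simp [hLv]⟩
  obtain ⟨L0, hL0, e0⟩ := hcoef hH (h p hp)
  obtain ⟨L1, hL1, e1⟩ := hsum fun j => hcoef (hb j) (analyticAt_dirDeriv (h p hp) (0, Pi.single j 1))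
  obtain ⟨L2, hL2, e2⟩ := hsum fun j => hsum fun k =>
    hcoef (differentiable_const (C j k))
      (analyticAt_dirDeriv (analyticAt_dirDeriv (h p hp) (0, Pi.single k 1)) (0, Pi.single j 1))
  have hL : HasFDerivAt (diffOpTime H b C Ψ) (L0 + L1 + L2) p := (hL0.add hL1).add hL2
  unfold dirDeriv
  rw [hL.fderiv]
  simp only [_root_.add_apply, e0, e1, e2]
  unfold diffOpTime
  congr 1
  · congr 1
    exact Finset.sum_congr rfl fun j _ => by rw [dirDeriv_comm (h p hp)]; rfl
  · refine Finset.sum_congr rfl fun j _ => Finset.sum_congr rfl fun k _ => ?_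
    rw [dirDeriv_comm (analyticAt_dirDeriv (h p hp) _),
      dirDeriv_congr hΩ (fun q hq => dirDeriv_comm (h q hq) (1, 0) (0, Pi.single k 1)) _ hp]
    rfl

lemma deriv_slice {Ψ : ℂ × (Idx m → ℂ) → ℂ} {t : ℂ} {u : Idx m → ℂ}
    (h : AnalyticAt ℂ Ψ (t, u)) : deriv (fun z => Ψ (z, u)) t = dirDeriv (1, 0) Ψ (t, u) := by
  have h1 : HasFDerivAt (fun z => Ψ (z, u)) _ t :=
    h.differentiableAt.hasFDerivAt.comp t (hasFDerivAt_prodMk_left t u)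
  rw [h1.hasDerivAt.deriv]
  simp [dirDeriv]

/-- Induction on n over all pairs of solutions: their t-derivatives are solutions too, and these
agree at t₀ because each is the spatial operator applied to the common value at t₀. -/
lemma iteratedDeriv_evolution_eq {B : Set ℂ} (hB : IsOpen B) {t₀ : ℂ} (ht₀ : t₀ ∈ B)
    {H : (Idx m → ℂ) → ℂ} (hH : Differentiable ℂ H) {b : Idx m → (Idx m → ℂ) → ℂ}
    (hb : ∀ j, Differentiable ℂ (b j)) (C : Matrix (Idx m) (Idx m) ℂ) (n : ℕ) :
    ∀ Ψ Θ : ℂ × (Idx m → ℂ) → ℂ, AnalyticOnNhd ℂ Ψ (B ×ˢ Set.univ) →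
      AnalyticOnNhd ℂ Θ (B ×ˢ Set.univ) →
      Set.EqOn (dirDeriv (1, 0) Ψ) (diffOpTime H b C Ψ) (B ×ˢ Set.univ) →
      Set.EqOn (dirDeriv (1, 0) Θ) (diffOpTime H b C Θ) (B ×ˢ Set.univ) →
      (∀ u, Ψ (t₀, u) = Θ (t₀, u)) → ∀ u,
        iteratedDeriv n (fun z => Ψ (z, u)) t₀ = iteratedDeriv n (fun z => Θ (z, u)) t₀ := by
  induction n with
  | zero => intro Ψ Θ _ _ _ _ h u; simpa using h u
  | succ n ih =>
    intro Ψ Θ hΨ hΘ eΨ eΘ h u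
    have hΩ : IsOpen (B ×ˢ (Set.univ : Set (Idx m → ℂ))) := hB.prod isOpen_univ
    have step : ∀ {Ψ : ℂ × (Idx m → ℂ) → ℂ}, AnalyticOnNhd ℂ Ψ (B ×ˢ Set.univ) →
        iteratedDeriv (n + 1) (fun z => Ψ (z, u)) t₀ =
          iteratedDeriv n (fun z => dirDeriv (1, 0) Ψ (z, u)) t₀ := by
      intro Ψ hΨ
      rw [iteratedDeriv_succ']
      refine Filter.EventuallyEq.iteratedDeriv_eq n ?_
      filter_upwards [hB.mem_nhds ht₀] with z hz
      exact deriv_slice (hΨ _ ⟨hz, trivial⟩)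
    have next : ∀ {Ψ : ℂ × (Idx m → ℂ) → ℂ}, AnalyticOnNhd ℂ Ψ (B ×ˢ Set.univ) →
        Set.EqOn (dirDeriv (1, 0) Ψ) (diffOpTime H b C Ψ) (B ×ˢ Set.univ) →
        Set.EqOn (dirDeriv (1, 0) (dirDeriv (1, 0) Ψ)) (diffOpTime H b C (dirDeriv (1, 0) Ψ))
          (B ×ˢ Set.univ) := fun hΨ e =>
      (dirDeriv_congr hΩ e _).trans (dirDeriv_diffOpTime hB hΨ hH hb C)
    rw [step hΨ, step hΘ]
    refine ih _ _ (fun p hp => analyticAt_dirDeriv (hΨ p hp) _) (fun p hp => analyticAt_dirDeriv (hΘ p hp) _)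
      (next hΨ eΨ) (next hΘ eΘ) (fun v => ?_) u
    rw [eΨ ⟨ht₀, trivial⟩, eΘ ⟨ht₀, trivial⟩, ← diffOp_slice hΨ ht₀, ← diffOp_slice hΘ ht₀,
      funext h]

/-- Solutions of the evolution equation on a connected open set which agree at one time are
equal. -/
lemma evolution_unique {B : Set ℂ} (hB : IsOpen B) (hBc : IsPreconnected B) {t₀ : ℂ}
    (ht₀ : t₀ ∈ B) {H : (Idx m → ℂ) → ℂ} (hH : Differentiable ℂ H)
    {b : Idx m → (Idx m → ℂ) → ℂ} (hb : ∀ j, Differentiable ℂ (b j))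
    {C : Matrix (Idx m) (Idx m) ℂ} {Ψ Θ : ℂ → (Idx m → ℂ) → ℂ}
    (hΨ : AnalyticOnNhd ℂ (fun p : ℂ × (Idx m → ℂ) => Ψ p.1 p.2) (B ×ˢ Set.univ))
    (hΘ : AnalyticOnNhd ℂ (fun p : ℂ × (Idx m → ℂ) => Θ p.1 p.2) (B ×ˢ Set.univ))
    (eΨ : ∀ t ∈ B, ∀ u, HasDerivAt (fun z => Ψ z u) (diffOp H b C (Ψ t) u) t)
    (eΘ : ∀ t ∈ B, ∀ u, HasDerivAt (fun z => Θ z u) (diffOp H b C (Θ t) u) t)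
    (h : ∀ u, Ψ t₀ u = Θ t₀ u) : ∀ t ∈ B, ∀ u, Ψ t u = Θ t u := by
  have conv : ∀ {Ψ : ℂ → (Idx m → ℂ) → ℂ},
      AnalyticOnNhd ℂ (fun p : ℂ × (Idx m → ℂ) => Ψ p.1 p.2) (B ×ˢ Set.univ) →
      (∀ t ∈ B, ∀ u, HasDerivAt (fun z => Ψ z u) (diffOp H b C (Ψ t) u) t) →
      Set.EqOn (dirDeriv (1, 0) (fun p : ℂ × (Idx m → ℂ) => Ψ p.1 p.2))
        (diffOpTime H b C (fun p : ℂ × (Idx m → ℂ) => Ψ p.1 p.2)) (B ×ˢ Set.univ) := by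
    intro Ψ hΨ e p hp
    rw [show p = (p.1, p.2) from rfl, ← deriv_slice (hΨ p hp), ← diffOp_slice hΨ hp.1]
    exact (e p.1 hp.1 p.2).deriv
  intro t ht u
  have slice : ∀ {Ψ : ℂ → (Idx m → ℂ) → ℂ},
      AnalyticOnNhd ℂ (fun p : ℂ × (Idx m → ℂ) => Ψ p.1 p.2) (B ×ˢ Set.univ) →
      AnalyticOnNhd ℂ (fun z => Ψ z u) B := fun {Ψ} hΨ z hz =>
    (hΨ (z, u) ⟨hz, trivial⟩).comp (f := fun z => (z, u)) (analyticAt_id.prod analyticAt_const)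
  have hd := (slice hΨ).sub (slice hΘ)
  have hz : ∀ᶠ z in 𝓝 t₀, ((fun z => Ψ z u) - fun z => Θ z u) z = 0 := by
    -- All t-derivatives of the difference vanish at t₀, so it vanishes to infinite order; the
    -- identity theorem spreads this over B.
    rw [← analyticOrderAt_eq_top, ENat.eq_top_iff_forall_ge]
    intro n
    rw [natCast_le_analyticOrderAt_iff_iteratedDeriv_eq_zero (hd t₀ ht₀)]
    intro i _
    rw [iteratedDeriv_sub (slice hΨ t₀ ht₀).contDiffAt (slice hΘ t₀ ht₀).contDiffAt, sub_eq_zero]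
    exact iteratedDeriv_evolution_eq hB ht₀ hH hb C i _ _ hΨ hΘ (conv hΨ eΨ) (conv hΘ eΘ) h u
  have := hd.eqOn_zero_of_preconnected_of_eventuallyEq_zero hBc ht₀ hz ht
  exact sub_eq_zero.1 this

lemma IsStarExpAlong.unique {ħ : ℝ} {K : Matrix (Idx m) (Idx m) ℂ} {A : Matrix (Idx m) (Idx m) ℂ}
    (hA : A.IsSymm) {α β : ℂ} {a : ℂ} {γ : Path (0 : ℂ) a} {F F' : unitInterval → (Idx m → ℂ) → ℂ}
    (hF : IsStarExpAlong ħ K (fun u => α * qform A u + β) γ F)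
    (hF' : IsStarExpAlong ħ K (fun u => α * qform A u + β) γ F') : F' = F := by
  have hdiff : Differentiable ℂ (fun u : Idx m → ℂ => α * qform A u + β) := fun u =>
    ((hasFDerivAt_qform hA u).differentiableAt.const_mul α).add_const β
  have hb : ∀ j, Differentiable ℂ (fun u : Idx m → ℂ =>
      Complex.I * ħ * α * (u ᵥ* (A * (K + Matrix.J (Fin m) ℂ))) j) := by
    intro j
    simp only [vecMul, dotProduct]
    fun_prop
  -- Near each time, agreement at one time forces agreement at all: both local solutions live over a
  -- common ball. The set of agreement is then open and closed.
  have key : ∀ s : unitInterval, ∃ N ∈ 𝓝 s, ∀ s₁ ∈ N, ∀ s₂ ∈ N,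
      (∀ u, F' s₁ u = F s₁ u) → ∀ u, F' s₂ u = F s₂ u := by
    intro s
    obtain ⟨U, hU, hsU, Φ, hΦ, eΦ, hs⟩ := hF.2 s
    obtain ⟨U', hU', hsU', Φ', hΦ', eΦ', hs'⟩ := hF'.2 s
    obtain ⟨r, hr, hball⟩ := Metric.isOpen_iff.1 (hU.inter hU') (γ s) ⟨hsU, hsU'⟩
    have hγ : ∀ᶠ s' in 𝓝 s, γ s' ∈ Metric.ball (γ s) r :=
      γ.continuous.continuousAt (Metric.ball_mem_nhds _ hr)
    refine ⟨_, hγ.and (hs.and hs'), ?_⟩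
    rintro s₁ ⟨h1, h2, h3⟩ s₂ ⟨k1, k2, k3⟩ heq u
    rw [k2, k3]
    simp only [starMul_quadratic ħ K hA] at eΦ eΦ'
    have sub : Metric.ball (γ s) r ×ˢ (Set.univ : Set (Idx m → ℂ)) ⊆ U ×ˢ Set.univ :=
      Set.prod_mono (fun z hz => (hball hz).1) subset_rfl
    have sub' : Metric.ball (γ s) r ×ˢ (Set.univ : Set (Idx m → ℂ)) ⊆ U' ×ˢ Set.univ :=
      Set.prod_mono (fun z hz => (hball hz).2) subset_rfl
    exact evolution_unique Metric.isOpen_ball (convex_ball _ _).isPreconnected h1 hdiff hb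
      (hΦ'.mono sub') (hΦ.mono sub) (fun t ht => eΦ' t (hball ht).2)
      (fun t ht => eΦ t (hball ht).1) (fun v => by rw [← h3, ← h2, heq]) _ k1 u
  have hclopen : IsClopen {s : unitInterval | ∀ u, F' s u = F s u} := by
    constructor
    · rw [← isOpen_compl_iff, isOpen_iff_mem_nhds]
      intro s hs
      obtain ⟨N, hN, h⟩ := key s
      filter_upwards [hN] with s' hs' h'
      exact hs (h s' hs' s (mem_of_mem_nhds hN) h')
    · rw [isOpen_iff_mem_nhds]
      intro s hs
      obtain ⟨N, hN, h⟩ := key s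
      filter_upwards [hN] with s' hs'
      exact h s (mem_of_mem_nhds hN) s' hs' hs
  have huniv := hclopen.eq_univ ⟨0, fun u => by rw [hF.1, hF'.1]⟩
  funext s u
  exact (huniv ▸ Set.mem_univ s : s ∈ {s : unitInterval | ∀ u, F' s u = F s u}) u

end Uniqueness

/-! ### Second order operators acting on Gaussians -/

section Gaussians

variable {m : ℕ}

lemma hasFDerivAt_gaussian {Q : Matrix (Idx m) (Idx m) ℂ} (hQ : Q.IsSymm) (a c : ℂ)
    (u : Idx m → ℂ) :
    HasFDerivAt (fun u => a * Complex.exp (c * qform Q u))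
      ((2 * c * (a * Complex.exp (c * qform Q u))) • bform Q u) u := by
  refine ((((hasFDerivAt_qform hQ u).const_mul c).cexp).const_mul a).congr_fderiv ?_
  simp only [smul_smul]
  congr 1
  ring

lemma fderiv_fderiv_gaussian {Q : Matrix (Idx m) (Idx m) ℂ} (hQ : Q.IsSymm) (a c : ℂ)
    (u v w : Idx m → ℂ) :
    fderiv ℂ (fderiv ℂ (fun u => a * Complex.exp (c * qform Q u))) u v w =
      a * Complex.exp (c * qform Q u) *
        ((2 * c) ^ 2 * (bform Q u v * bform Q u w) + 2 * c * bform Q v w) := by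
  have h1 : fderiv ℂ (fun u => a * Complex.exp (c * qform Q u)) =
      fun u => (2 * c * (a * Complex.exp (c * qform Q u))) • bform Q u :=
    funext fun u => (hasFDerivAt_gaussian hQ a c u).fderiv
  have h2 : HasFDerivAt (fun u => (2 * c * (a * Complex.exp (c * qform Q u))) • bform Q u) _ u :=
    ((hasFDerivAt_gaussian hQ a c u).const_mul (2 * c)).smul (bform Q).hasFDerivAt
  rw [h1, h2.fderiv]
  simp
  ring

lemma sum_bform_mul {ι : Type*} [Fintype ι] {Q : Matrix ι ι ℂ} (hQ : Q.IsSymm)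
    (B : Matrix ι ι ℂ) (u : ι → ℂ) :
    ∑ j, (u ᵥ* B) j * (u ᵥ* Q) j = qform (B * Q) u := by
  have : u ᵥ* Q = Q *ᵥ u := by rw [← Matrix.mulVec_transpose, hQ.eq]
  change (u ᵥ* B) ⬝ᵥ (u ᵥ* Q) = _
  rw [this, Matrix.dotProduct_mulVec, Matrix.vecMul_vecMul, qform]

lemma diffOp_gaussian {Q : Matrix (Idx m) (Idx m) ℂ} (hQ : Q.IsSymm) (a c : ℂ)
    (H : (Idx m → ℂ) → ℂ) (B C : Matrix (Idx m) (Idx m) ℂ) (u : Idx m → ℂ) :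
    diffOp H (fun j u => (u ᵥ* B) j) C (fun u => a * Complex.exp (c * qform Q u)) u =
      a * Complex.exp (c * qform Q u) * (H u + 2 * c * qform (B * Q) u +
        (2 * c) ^ 2 * qform (Q * C * Q) u + 2 * c * (C * Q).trace) := by
  have h1 : ∑ j, ∑ k, C j k * ((u ᵥ* Q) j * (u ᵥ* Q) k) = qform (Q * C * Q) u := by
    have := qform_vecMul C Q u
    rw [hQ.eq] at this
    rw [← this, qform_eq_sum]
    exact Finset.sum_congr rfl fun j _ => Finset.sum_congr rfl fun k _ => by ring
  have h2 : ∑ j, ∑ k, C j k * Q j k = (C * Q).trace := by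
    simp only [Matrix.trace, Matrix.diag_apply, Matrix.mul_apply]
    refine Finset.sum_congr rfl fun j _ => Finset.sum_congr rfl fun k _ => ?_
    rw [show Q k j = Q j k from congrFun (congrFun hQ.eq j) k]
  have h3 : ∀ j k, bform Q (Pi.single j 1) (Pi.single k 1) = Q j k := bform_single_single Q
  rw [← h1, ← h2, ← sum_bform_mul hQ]
  simp only [diffOp, fderiv_fderiv_gaussian hQ, (hasFDerivAt_gaussian hQ a c u).fderiv,
    _root_.smul_apply, h3, smul_eq_mul]
  simp only [bform_single_right]
  simp only [mul_add, Finset.mul_sum, Finset.sum_add_distrib]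
  rw [add_assoc (_ + _)]
  congr 1
  · congr 1
    · ring
    · exact Finset.sum_congr rfl fun j _ => by ring
  · congr 1 <;>
      exact Finset.sum_congr rfl fun j _ => Finset.sum_congr rfl fun k _ => by ring

end Gaussians

/-! ### Derivatives of the inverse and of the determinant of cos(t/2) - sin(t/2) L -/

section Amplitude

variable {ι : Type*} [DecidableEq ι]

/-- The matrix `cos (t/2) I - sin (t/2) L`. -/
def ampMatrix (L : Matrix ι ι ℂ) (t : ℂ) : Matrix ι ι ℂ :=
  Complex.cos (t / 2) • (1 : Matrix ι ι ℂ) - Complex.sin (t / 2) • L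

lemma differentiable_ampMatrix_apply (L : Matrix ι ι ℂ) (i j : ι) :
    Differentiable ℂ fun t => ampMatrix L t i j := by
  simp only [ampMatrix, Matrix.sub_apply, Matrix.smul_apply]
  fun_prop

variable [Fintype ι]

lemma differentiable_det {M : ℂ → Matrix ι ι ℂ} (h : ∀ i j, Differentiable ℂ fun t => M t i j) :
    Differentiable ℂ fun t => (M t).det := by
  simp only [Matrix.det_apply]
  fun_prop

lemma differentiable_det_ampMatrix (L : Matrix ι ι ℂ) :
    Differentiable ℂ fun t => (ampMatrix L t).det :=
  differentiable_det (differentiable_ampMatrix_apply L)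

lemma analyticAt_inv_ampMatrix {L : Matrix ι ι ℂ} {t : ℂ} (ht : (ampMatrix L t).det ≠ 0) (i j : ι) :
    AnalyticAt ℂ (fun t => (ampMatrix L t)⁻¹ i j) t := by
  simp only [Matrix.inv_def, Ring.inverse_eq_inv', Matrix.smul_apply, smul_eq_mul]
  refine ((differentiable_det_ampMatrix L).analyticAt t).inv ht |>.mul ?_
  refine Differentiable.analyticAt ?_ t
  simp only [Matrix.adjugate_apply]
  refine differentiable_det fun a b => ?_
  by_cases h : a = j
  · subst h; simp
  · simpa [Matrix.updateRow_ne h] using differentiable_ampMatrix_apply L a b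

lemma commute_ampMatrix (L : Matrix ι ι ℂ) (t : ℂ) : Commute (ampMatrix L t) L :=
  ((Commute.one_left L).smul_left _).sub_left ((Commute.refl L).smul_left _)

lemma ampMatrix_mul_inv {L : Matrix ι ι ℂ} {t : ℂ} (ht : (ampMatrix L t).det ≠ 0) :
    ampMatrix L t * (ampMatrix L t)⁻¹ = 1 :=
  Matrix.mul_nonsing_inv _ (isUnit_iff_ne_zero.2 ht)

lemma inv_mul_ampMatrix {L : Matrix ι ι ℂ} {t : ℂ} (ht : (ampMatrix L t).det ≠ 0) :
    (ampMatrix L t)⁻¹ * ampMatrix L t = 1 :=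
  Matrix.nonsing_inv_mul _ (isUnit_iff_ne_zero.2 ht)

lemma commute_inv_ampMatrix {L : Matrix ι ι ℂ} {t : ℂ} (ht : (ampMatrix L t).det ≠ 0) :
    Commute (ampMatrix L t)⁻¹ L :=
  calc (ampMatrix L t)⁻¹ * L
      = (ampMatrix L t)⁻¹ * (L * ampMatrix L t) * (ampMatrix L t)⁻¹ := by
        rw [Matrix.mul_assoc, Matrix.mul_assoc L, ampMatrix_mul_inv ht, Matrix.mul_one]
    _ = L * (ampMatrix L t)⁻¹ := by
        rw [← (commute_ampMatrix L t).eq, ← Matrix.mul_assoc, inv_mul_ampMatrix ht, Matrix.one_mul]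

/-- The addition formula for the sine: clearing the two inverses, the terms in L cancel. This exact
difference formula replaces the differentiation of a matrix inverse. -/
lemma smul_inv_ampMatrix_sub {L : Matrix ι ι ℂ} {t z : ℂ} (ht : (ampMatrix L t).det ≠ 0)
    (hz : (ampMatrix L z).det ≠ 0) :
    Complex.sin (z / 2) • (ampMatrix L z)⁻¹ - Complex.sin (t / 2) • (ampMatrix L t)⁻¹ =
      Complex.sin ((z - t) / 2) • ((ampMatrix L z)⁻¹ * (ampMatrix L t)⁻¹) := by
  have h1 : Complex.sin (z / 2) • ampMatrix L t - Complex.sin (t / 2) • ampMatrix L z =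
      Complex.sin ((z - t) / 2) • 1 := by
    rw [sub_div, Complex.sin_sub]
    ext i j
    simp only [ampMatrix, Matrix.sub_apply, Matrix.smul_apply, smul_eq_mul]
    ring
  calc _ = (ampMatrix L z)⁻¹ * (Complex.sin (z / 2) • ampMatrix L t -
        Complex.sin (t / 2) • ampMatrix L z) * (ampMatrix L t)⁻¹ := by
        rw [Matrix.mul_sub, Matrix.sub_mul, Matrix.mul_smul, Matrix.mul_smul,
          inv_mul_ampMatrix hz, Matrix.smul_mul, Matrix.mul_assoc, ampMatrix_mul_inv ht,
          Matrix.mul_one, Matrix.smul_mul, Matrix.one_mul]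
    _ = _ := by rw [h1, Matrix.mul_smul, Matrix.smul_mul, Matrix.mul_one]

lemma eventually_ampMatrix_det_ne_zero {L : Matrix ι ι ℂ} {t : ℂ} (ht : (ampMatrix L t).det ≠ 0) :
    ∀ᶠ z in 𝓝 t, (ampMatrix L z).det ≠ 0 :=
  (differentiable_det_ampMatrix L).continuous.continuousAt.eventually_ne ht

lemma hasDerivAt_qform_inv_ampMatrix {L : Matrix ι ι ℂ} {t : ℂ} (ht : (ampMatrix L t).det ≠ 0)
    (y : ι → ℂ) :
    HasDerivAt (fun z => qform (Complex.sin (z / 2) • (ampMatrix L z)⁻¹) y)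
      (1 / 2 * qform ((ampMatrix L t)⁻¹ * (ampMatrix L t)⁻¹) y) t := by
  have hk : DifferentiableAt ℂ (fun z => qform ((ampMatrix L z)⁻¹ * (ampMatrix L t)⁻¹) y) t := by
    simp only [qform_eq_sum, Matrix.mul_apply]
    exact DifferentiableAt.fun_sum fun i _ => DifferentiableAt.fun_sum fun j _ =>
      ((DifferentiableAt.fun_sum fun k _ =>
        (analyticAt_inv_ampMatrix ht i k).differentiableAt.mul_const _).mul_const _).mul_const _
  have hs : HasDerivAt (fun z : ℂ => Complex.sin ((z - t) / 2)) (1 / 2) t := by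
    have := (((hasDerivAt_id t).sub_const t).div_const 2).csin
    simpa using this
  have h1 := (hs.mul hk.hasDerivAt).const_add (qform (Complex.sin (t / 2) • (ampMatrix L t)⁻¹) y)
  -- The factor sin((z - t)/2) vanishes at z = t, so the derivative of the inverse never enters and
  -- only its value at t does.
  simp only [sub_self, zero_div, Complex.sin_zero, zero_mul, add_zero] at h1
  refine h1.congr_of_eventuallyEq ?_
  filter_upwards [eventually_ampMatrix_det_ne_zero ht] with z hz
  simp only [Pi.mul_apply]
  rw [← qform_smul, ← smul_inv_ampMatrix_sub ht hz, ← qform_add]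
  congr 1
  abel

lemma hasDerivAt_det_one_add_smul (M : Matrix ι ι ℂ) :
    HasDerivAt (fun r : ℂ => (1 + r • M).det) M.trace 0 := by
  obtain ⟨P, hP⟩ : ∃ P : Polynomial ℂ, ∀ r : ℂ,
      (1 + r • M).det = 1 + M.trace * r + P.eval r * r ^ 2 :=
    ⟨_, fun r => Matrix.det_one_add_smul r M⟩
  rw [funext hP]
  have h1 : HasDerivAt (fun r : ℂ => 1 + M.trace * r + P.eval r * r ^ 2) _ 0 :=
    (((hasDerivAt_id (0 : ℂ)).const_mul M.trace).const_add 1).add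
      ((P.hasDerivAt 0).mul (hasDerivAt_pow 2 (0 : ℂ)))
  simpa using h1

/-- With h = (z - t)/2, the addition formulas factor the matrix at z as cos h · (1 - tan h · N)
times the matrix at t. As cos h is stationary at h = 0, only the trace of N contributes. -/
lemma hasDerivAt_det_ampMatrix {L : Matrix ι ι ℂ} {t : ℂ} (ht : (ampMatrix L t).det ≠ 0) :
    HasDerivAt (fun z => (ampMatrix L z).det) ((ampMatrix L t).det *
      (-(1 / 2) * ((Complex.sin (t / 2) • 1 + Complex.cos (t / 2) • L) *
        (ampMatrix L t)⁻¹).trace)) t := by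
  set N := (Complex.sin (t / 2) • 1 + Complex.cos (t / 2) • L) * (ampMatrix L t)⁻¹ with hN
  have htan : HasDerivAt (fun z : ℂ => -Complex.tan ((z - t) / 2)) (-(1 / 2)) t := by
    have h2 : HasDerivAt (fun z : ℂ => (z - t) / 2) (1 / 2) t :=
      ((hasDerivAt_id t).sub_const t).div_const 2
    have h3 : HasDerivAt Complex.tan (1 / Complex.cos 0 ^ 2) ((t - t) / 2) := by
      rw [sub_self, zero_div]
      exact Complex.hasDerivAt_tan (by simp)
    have h4 := h3.comp t h2
    simpa [Function.comp_def] using h4.fun_neg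
  have hcos : HasDerivAt (fun z : ℂ => Complex.cos ((z - t) / 2)) 0 t := by
    have := (((hasDerivAt_id t).sub_const t).div_const 2).ccos
    simpa using this
  have hdet : HasDerivAt (fun z => (1 + (-Complex.tan ((z - t) / 2)) • N).det)
      (N.trace * (-(1 / 2))) t := by
    have h3 : HasDerivAt (fun r : ℂ => (1 + r • N).det) N.trace (-Complex.tan ((t - t) / 2)) := by
      simpa using hasDerivAt_det_one_add_smul N
    exact h3.comp t htan
  have h1 := (((hcos.pow (Fintype.card ι)).mul hdet)).const_mul (ampMatrix L t).det
  refine (h1.congr_deriv (by simp [mul_comm])).congr_of_eventuallyEq ?_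
  have : ∀ᶠ z in 𝓝 t, Complex.cos ((z - t) / 2) ≠ 0 :=
    hcos.continuousAt.eventually_ne (by simp)
  filter_upwards [this] with z hz
  simp only [Pi.mul_apply, Pi.pow_apply]
  rw [← Matrix.det_smul, mul_comm, ← Matrix.det_mul]
  congr 1
  have hNX : N * ampMatrix L t = Complex.sin (t / 2) • 1 + Complex.cos (t / 2) • L := by
    rw [hN, Matrix.mul_assoc, inv_mul_ampMatrix ht, Matrix.mul_one]
  rw [Matrix.smul_mul, Matrix.add_mul, Matrix.one_mul, Matrix.smul_mul, hNX, smul_add, smul_smul,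
    mul_neg, mul_comm, Complex.tan_mul_cos hz]
  have hz2 : z / 2 = (z - t) / 2 + t / 2 := by ring
  rw [ampMatrix, hz2, Complex.cos_add, Complex.sin_add]
  ext i j
  simp only [ampMatrix, Matrix.sub_apply, Matrix.add_apply, Matrix.smul_apply, smul_eq_mul]
  ring

end Amplitude

/-! ### The Gaussian solution of the evolution equation -/

section Existence

variable {m : ℕ}

/-- The matrix of the exponent of the star exponential. -/
def phaseMatrix (K g : Matrix (Idx m) (Idx m) ℂ) (t : ℂ) : Matrix (Idx m) (Idx m) ℂ :=
  g * (Complex.sin (t / 2) • (ampMatrix (gᵀ * K * g) t)⁻¹) * gᵀ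

/-- The star exponential, with the value `r` of the square root in its amplitude. -/
def gaussianExp (ħ : ℝ) (K g : Matrix (Idx m) (Idx m) ℂ) (r t : ℂ) (u : Idx m → ℂ) : ℂ :=
  r⁻¹ * Complex.exp (1 / (Complex.I * ħ) * qform (phaseMatrix K g t) u)

lemma ampDet_eq (K g : Matrix (Idx m) (Idx m) ℂ) (t : ℂ) :
    ampDet K g t = (ampMatrix (gᵀ * K * g) t).det := rfl

lemma isSymm_conj_transpose {K : Matrix (Idx m) (Idx m) ℂ} (hK : K.IsSymm)
    (g : Matrix (Idx m) (Idx m) ℂ) : (gᵀ * K * g).IsSymm := by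
  simp only [Matrix.IsSymm, Matrix.transpose_mul, Matrix.transpose_transpose, hK.eq,
    Matrix.mul_assoc]

lemma isSymm_inv_ampMatrix {L : Matrix (Idx m) (Idx m) ℂ} (hL : L.IsSymm) (t : ℂ) :
    ((ampMatrix L t)⁻¹).IsSymm := by
  rw [Matrix.IsSymm, Matrix.transpose_nonsing_inv]
  simp only [ampMatrix, Matrix.transpose_sub, Matrix.transpose_smul, Matrix.transpose_one, hL.eq]

lemma isSymm_phaseMatrix {K : Matrix (Idx m) (Idx m) ℂ} (hK : K.IsSymm)
    (g : Matrix (Idx m) (Idx m) ℂ) (t : ℂ) : (phaseMatrix K g t).IsSymm := by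
  have := (isSymm_inv_ampMatrix (isSymm_conj_transpose hK g) t).eq
  unfold phaseMatrix
  set Y := (ampMatrix (gᵀ * K * g) t)⁻¹
  simp only [Matrix.IsSymm, Matrix.transpose_mul, Matrix.transpose_transpose,
    Matrix.transpose_smul, this, Matrix.mul_assoc]

/-- As ᵗgJg = J, multiplying by ᵗg turns K + J into L + J; writing 1 as (cos(t/2) - sin(t/2) L)Y
cancels L and leaves the rotation cos(t/2) + sin(t/2) J. -/
lemma transpose_mul_one_add_phaseMatrix {K g : Matrix (Idx m) (Idx m) ℂ}
    (hg : g ∈ Matrix.symplecticGroup (Fin m) ℂ) {t : ℂ} (ht : ampDet K g t ≠ 0) :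
    gᵀ * (1 + (K + Matrix.J (Fin m) ℂ) * phaseMatrix K g t) =
      (Complex.cos (t / 2) • 1 + Complex.sin (t / 2) • Matrix.J (Fin m) ℂ) *
        (ampMatrix (gᵀ * K * g) t)⁻¹ * gᵀ := by
  have hJ := SymplecticGroup.mem_iff'.1 hg
  have hY := ampMatrix_mul_inv (L := gᵀ * K * g) ht
  set L := gᵀ * K * g with hL
  set Y := (ampMatrix L t)⁻¹
  have h1 : gᵀ * ((K + Matrix.J (Fin m) ℂ) * phaseMatrix K g t) =
      Complex.sin (t / 2) • ((L + Matrix.J (Fin m) ℂ) * Y * gᵀ) := by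
    have : L + Matrix.J (Fin m) ℂ = gᵀ * (K + Matrix.J (Fin m) ℂ) * g := by
      rw [Matrix.mul_add, Matrix.add_mul, hJ]
    rw [this]
    change gᵀ * ((K + Matrix.J (Fin m) ℂ) * (g * (Complex.sin (t / 2) • Y) * gᵀ)) = _
    simp only [Matrix.mul_smul, Matrix.smul_mul, Matrix.mul_assoc]
  rw [Matrix.mul_add, h1, Matrix.mul_one]
  have h2 : gᵀ + Complex.sin (t / 2) • ((L + Matrix.J (Fin m) ℂ) * Y * gᵀ) =
      (ampMatrix L t * Y) * gᵀ + Complex.sin (t / 2) • ((L + Matrix.J (Fin m) ℂ) * Y * gᵀ) := by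
    rw [hY, Matrix.one_mul]
  rw [h2, ← Matrix.smul_mul, ← Matrix.smul_mul, ← Matrix.add_mul, ← Matrix.add_mul]
  congr 2
  rw [ampMatrix, smul_add]
  abel

/-- The rotation W = cos(t/2) + sin(t/2) J satisfies ᵗWW = 1 and drops out. The left side is the
quadratic part of H *_K on the Gaussian, the right side is 2Q'. -/
lemma riccati_phaseMatrix {K g : Matrix (Idx m) (Idx m) ℂ} (hK : K.IsSymm)
    (hg : g ∈ Matrix.symplecticGroup (Fin m) ℂ) {t : ℂ} (ht : ampDet K g t ≠ 0) :
    (1 + (K + Matrix.J (Fin m) ℂ) * phaseMatrix K g t)ᵀ * (g * gᵀ) *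
        (1 + (K + Matrix.J (Fin m) ℂ) * phaseMatrix K g t) =
      g * ((ampMatrix (gᵀ * K * g) t)⁻¹ * (ampMatrix (gᵀ * K * g) t)⁻¹) * gᵀ := by
  have h := transpose_mul_one_add_phaseMatrix hg ht
  have hYs := (isSymm_inv_ampMatrix (isSymm_conj_transpose hK g) t).eq
  set S := 1 + (K + Matrix.J (Fin m) ℂ) * phaseMatrix K g t
  set Y := (ampMatrix (gᵀ * K * g) t)⁻¹
  set W := Complex.cos (t / 2) • (1 : Matrix (Idx m) (Idx m) ℂ) +
    Complex.sin (t / 2) • Matrix.J (Fin m) ℂ with hW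
  have hWW : Wᵀ * W = 1 := by
    rw [hW]
    simp only [Matrix.transpose_add, Matrix.transpose_smul, Matrix.transpose_one,
      Matrix.J_transpose, Matrix.add_mul, Matrix.mul_add, Matrix.smul_mul, Matrix.mul_smul,
      Matrix.one_mul, Matrix.mul_one, Matrix.neg_mul, Matrix.J_squared, neg_neg]
    have h1 := Complex.sin_sq_add_cos_sq (t / 2)
    ext i j
    simp only [Matrix.add_apply, Matrix.smul_apply, Matrix.neg_apply, smul_eq_mul]
    linear_combination ((1 : Matrix (Idx m) (Idx m) ℂ) i j) * h1
  calc Sᵀ * (g * gᵀ) * S = (gᵀ * S)ᵀ * (gᵀ * S) := by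
        simp only [Matrix.transpose_mul, Matrix.transpose_transpose, Matrix.mul_assoc]
    _ = g * (Y * (Wᵀ * W) * Y) * gᵀ := by
        rw [h]
        simp only [Matrix.transpose_mul, Matrix.transpose_transpose, hYs, Matrix.mul_assoc]
    _ = _ := by rw [hWW, Matrix.mul_one]

/-- Conjugated by g, the second trace is sin(t/2) tr((L - J)(L + J)Y). The mixed terms cancel under
the trace because Y commutes with L, and -J² contributes tr Y. The result is -2D'/D. -/
lemma trace_phaseMatrix {K g : Matrix (Idx m) (Idx m) ℂ} (hK : K.IsSymm)
    (hg : g ∈ Matrix.symplecticGroup (Fin m) ℂ) {t : ℂ} (ht : ampDet K g t ≠ 0) :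
    (gᵀ * K * g).trace + ((K + Matrix.J (Fin m) ℂ)ᵀ * (g * gᵀ) * (K + Matrix.J (Fin m) ℂ) *
        phaseMatrix K g t).trace =
      ((Complex.sin (t / 2) • 1 + Complex.cos (t / 2) • (gᵀ * K * g)) *
        (ampMatrix (gᵀ * K * g) t)⁻¹).trace := by
  have hJ := SymplecticGroup.mem_iff'.1 hg
  have hY := ampMatrix_mul_inv (L := gᵀ * K * g) ht
  have hYc := commute_inv_ampMatrix (L := gᵀ * K * g) ht
  have hJ2 := Matrix.J_squared (Fin m) ℂ
  set J := Matrix.J (Fin m) ℂ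
  have hJt : Jᵀ = -J := Matrix.J_transpose (Fin m) ℂ
  have e1 : ((K + J)ᵀ * (g * gᵀ) * (K + J) * phaseMatrix K g t).trace =
      Complex.sin (t / 2) *
        ((gᵀ * K * g - J) * (gᵀ * K * g + J) * (ampMatrix (gᵀ * K * g) t)⁻¹).trace := by
    have : gᵀ * K * g - J = gᵀ * (K + J)ᵀ * g := by
      rw [Matrix.transpose_add, hK.eq, hJt, Matrix.mul_add, Matrix.add_mul, Matrix.mul_neg,
        Matrix.neg_mul, hJ, sub_eq_add_neg]
    have h2 : gᵀ * K * g + J = gᵀ * (K + J) * g := by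
      rw [Matrix.mul_add, Matrix.add_mul, hJ]
    rw [this, h2, phaseMatrix, ← smul_eq_mul (Complex.sin (t / 2)), ← Matrix.trace_smul,
      ← Matrix.mul_assoc _ _ gᵀ, Matrix.trace_mul_comm _ gᵀ]
    set Y := (ampMatrix (gᵀ * K * g) t)⁻¹
    simp only [Matrix.mul_smul, Matrix.mul_assoc]
  rw [e1]
  set L := gᵀ * K * g
  set Y := (ampMatrix L t)⁻¹
  have e2 : (L * J * Y).trace = (J * L * Y).trace := by
    rw [Matrix.mul_assoc, Matrix.trace_mul_comm, Matrix.mul_assoc, hYc.eq, ← Matrix.mul_assoc]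
  have e3 : ((L - J) * (L + J) * Y).trace = (L * L * Y).trace + Y.trace := by
    have : (L - J) * (L + J) * Y = L * L * Y + L * J * Y - J * L * Y + Y := by
      simp only [Matrix.sub_mul, Matrix.mul_add, Matrix.add_mul, hJ2, Matrix.neg_mul,
        Matrix.one_mul]
      abel
    rw [this, Matrix.trace_add, Matrix.trace_sub, Matrix.trace_add, e2]
    ring
  have e4 : L.trace = Complex.cos (t / 2) * (L * Y).trace -
      Complex.sin (t / 2) * (L * L * Y).trace := by
    conv_lhs => rw [← Matrix.mul_one L, ← hY, ampMatrix]
    simp only [Matrix.sub_mul, Matrix.mul_sub, Matrix.smul_mul, Matrix.mul_smul, Matrix.one_mul,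
      Matrix.trace_sub, Matrix.trace_smul, smul_eq_mul, Matrix.mul_assoc]
  rw [e3, e4]
  simp only [Matrix.add_mul, Matrix.smul_mul, Matrix.one_mul, Matrix.trace_add, Matrix.trace_smul,
    smul_eq_mul]
  ring

lemma starMul_gaussianExp {ħ : ℝ} (hħ : 0 < ħ) {K g : Matrix (Idx m) (Idx m) ℂ} (hK : K.IsSymm)
    (hg : g ∈ Matrix.symplecticGroup (Fin m) ℂ) {t : ℂ} (ht : ampDet K g t ≠ 0) (r : ℂ)
    (u : Idx m → ℂ) :
    starMul ħ K (quadHam ħ K g) (gaussianExp ħ K g r t) u = gaussianExp ħ K g r t u *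
      (1 / 4 * ((Complex.sin (t / 2) • 1 + Complex.cos (t / 2) • (gᵀ * K * g)) *
        (ampMatrix (gᵀ * K * g) t)⁻¹).trace + 1 / (Complex.I * ħ) * (1 / 2 * qform
          ((ampMatrix (gᵀ * K * g) t)⁻¹ * (ampMatrix (gᵀ * K * g) t)⁻¹) (u ᵥ* g))) := by
  have hA : (g * gᵀ).IsSymm := by simp [Matrix.IsSymm]
  have hQ := isSymm_phaseMatrix hK g t
  have hne : (ħ : ℂ) ≠ 0 := by exact_mod_cast hħ.ne'
  have hI0 := Complex.I_ne_zero
  rw [quadHam_eq hħ, starMul_quadratic ħ K hA, ← trace_phaseMatrix hK hg ht, qform_vecMul,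
    ← riccati_phaseMatrix hK hg ht]
  set Λ := K + Matrix.J (Fin m) ℂ
  set Q := phaseMatrix K g t
  have hB : (fun j (u : Idx m → ℂ) => Complex.I * ħ * (1 / (2 * Complex.I * ħ)) *
      (u ᵥ* (g * gᵀ * Λ)) j) = fun j u => (u ᵥ* ((1 / 2 : ℂ) • (g * gᵀ * Λ))) j := by
    funext j u
    rw [Matrix.vecMul_smul, Pi.smul_apply, smul_eq_mul]
    congr 1
    field_simp
  rw [hB]
  unfold gaussianExp
  rw [diffOp_gaussian hQ]
  have hsymm : qform (Q * Λᵀ * (g * gᵀ)) u = qform (g * gᵀ * Λ * Q) u := by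
    have : Q * Λᵀ * (g * gᵀ) = (g * gᵀ * Λ * Q)ᵀ := by
      simp only [Matrix.transpose_mul, Matrix.transpose_transpose, hQ.eq, Matrix.mul_assoc]
    rw [this, qform, Matrix.vecMul_transpose, dotProduct_comm, Matrix.dotProduct_mulVec, qform]
  have e1 : (1 + Λ * Q)ᵀ * (g * gᵀ) * (1 + Λ * Q) = g * gᵀ + g * gᵀ * Λ * Q +
      Q * Λᵀ * (g * gᵀ) + Q * (Λᵀ * (g * gᵀ) * Λ) * Q := by
    simp only [Matrix.transpose_add, Matrix.transpose_one, Matrix.transpose_mul, hQ.eq,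
      Matrix.add_mul, Matrix.mul_add, Matrix.one_mul, Matrix.mul_one, Matrix.mul_assoc]
    abel
  rw [e1]
  simp only [qform_add, hsymm, Matrix.smul_mul, Matrix.mul_smul, qform_smul, Matrix.trace_smul,
    smul_eq_mul]
  congr 1
  field_simp
  ring

lemma analyticAt_phaseMatrix {K g : Matrix (Idx m) (Idx m) ℂ} {t : ℂ} (ht : ampDet K g t ≠ 0)
    (i j : Idx m) : AnalyticAt ℂ (fun z => phaseMatrix K g z i j) t := by
  have hs : AnalyticAt ℂ (fun z : ℂ => Complex.sin (z / 2)) t :=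
    Differentiable.analyticAt (by fun_prop) t
  simp only [phaseMatrix, Matrix.mul_apply, Matrix.smul_apply, smul_eq_mul]
  exact Finset.analyticAt_fun_sum _ fun k _ => (Finset.analyticAt_fun_sum _ fun l _ =>
    analyticAt_const.mul (hs.mul (analyticAt_inv_ampMatrix ht _ _))).mul analyticAt_const

lemma analyticAt_gaussianExp (ħ : ℝ) {K g : Matrix (Idx m) (Idx m) ℂ} {t : ℂ}
    (ht : ampDet K g t ≠ 0) {ρ : ℂ → ℂ} (hρ : AnalyticAt ℂ ρ t) (h0 : ρ t ≠ 0) (u : Idx m → ℂ) :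
    AnalyticAt ℂ (fun p : ℂ × (Idx m → ℂ) => gaussianExp ħ K g (ρ p.1) p.1 p.2) (t, u) := by
  have hfst : AnalyticAt ℂ (fun p : ℂ × (Idx m → ℂ) => p.1) (t, u) := analyticAt_fst
  have hcoord : ∀ i, AnalyticAt ℂ (fun p : ℂ × (Idx m → ℂ) => p.2 i) (t, u) := fun i =>
    ((ContinuousLinearMap.proj (R := ℂ) (φ := fun _ : Idx m => ℂ) i).analyticAt u).comp
      (f := fun p : ℂ × (Idx m → ℂ) => p.2) (x := (t, u)) analyticAt_snd
  have hQ : ∀ i j, AnalyticAt ℂ (fun p : ℂ × (Idx m → ℂ) => phaseMatrix K g p.1 i j) (t, u) :=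
    fun i j => (analyticAt_phaseMatrix ht i j).comp (f := fun p : ℂ × (Idx m → ℂ) => p.1)
      (x := (t, u)) hfst
  have hr : AnalyticAt ℂ (fun p : ℂ × (Idx m → ℂ) => ρ p.1) (t, u) :=
    hρ.comp (f := fun p : ℂ × (Idx m → ℂ) => p.1) (x := (t, u)) hfst
  simp only [gaussianExp, qform_eq_sum]
  refine (hr.inv h0).mul (AnalyticAt.cexp (analyticAt_const.mul ?_))
  exact Finset.analyticAt_fun_sum _ fun i _ => Finset.analyticAt_fun_sum _ fun j _ =>
    ((hQ i j).mul (hcoord i)).mul (hcoord j)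

/-- From ρ² = D one gets ρ'/ρ = D'/2D = -τ/4, which produces the trace term; the derivative of the
exponent produces the quadratic term. -/
lemma hasDerivAt_gaussianExp {ħ : ℝ} (hħ : 0 < ħ) {K g : Matrix (Idx m) (Idx m) ℂ}
    (hK : K.IsSymm) (hg : g ∈ Matrix.symplecticGroup (Fin m) ℂ) {t : ℂ} (ht : ampDet K g t ≠ 0)
    {ρ : ℂ → ℂ} (hρ : DifferentiableAt ℂ ρ t) (hsq : ∀ᶠ z in 𝓝 t, ρ z ^ 2 = ampDet K g z)
    (u : Idx m → ℂ) :
    HasDerivAt (fun z => gaussianExp ħ K g (ρ z) z u)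
      (starMul ħ K (quadHam ħ K g) (gaussianExp ħ K g (ρ t) t) u) t := by
  have h0 : ρ t ≠ 0 := by
    intro h
    have := hsq.self_of_nhds
    rw [h] at this
    exact ht (by rw [← this]; ring)
  have hD := hasDerivAt_det_ampMatrix (L := gᵀ * K * g) ht
  have hq := hasDerivAt_qform_inv_ampMatrix (L := gᵀ * K * g) ht (u ᵥ* g)
  rw [starMul_gaussianExp hħ hK hg ht]
  set τ := ((Complex.sin (t / 2) • 1 + Complex.cos (t / 2) • (gᵀ * K * g)) *
        (ampMatrix (gᵀ * K * g) t)⁻¹).trace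
  have hρ' : deriv ρ t = -(1 / 4) * τ * ρ t := by
    have h1 : HasDerivAt (fun z => ρ z ^ 2) _ t := hρ.hasDerivAt.pow 2
    have h2 := (h1.congr_of_eventuallyEq (f₁ := fun z => (ampMatrix (gᵀ * K * g) z).det)
      (hsq.mono fun z hz => hz.symm)).unique hD
    have h3 : (ampMatrix (gᵀ * K * g) t).det = ρ t ^ 2 := hsq.self_of_nhds.symm
    rw [h3] at h2
    have h4 : 2 * ρ t * (deriv ρ t - -(1 / 4) * τ * ρ t) = 0 := by
      push_cast at h2
      linear_combination h2
    exact sub_eq_zero.1 ((mul_eq_zero.1 h4).resolve_left (mul_ne_zero two_ne_zero h0))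
  have hQ : ∀ z, qform (phaseMatrix K g z) u =
      qform (Complex.sin (z / 2) • (ampMatrix (gᵀ * K * g) z)⁻¹) (u ᵥ* g) := fun z => by
    rw [qform_vecMul, phaseMatrix]
  have hinv : HasDerivAt (fun z => (ρ z)⁻¹) (1 / 4 * τ * (ρ t)⁻¹) t := by
    refine (hρ.hasDerivAt.fun_inv h0).congr_deriv ?_
    rw [hρ']
    field_simp
  simp only [gaussianExp, hQ]
  refine (hinv.fun_mul ((hq.const_mul (1 / (Complex.I * ħ))).cexp)).congr_deriv ?_
  ring

end Existence

/-! ### Local and pathwise square roots -/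

section SquareRoots

lemma eventually_eq_of_sq_eq {X : Type*} [TopologicalSpace X] {a b : X → ℂ} {x : X}
    (ha : ContinuousAt a x) (hb : ContinuousAt b x) (h : a x = b x) (h0 : b x ≠ 0)
    (hsq : ∀ᶠ y in 𝓝 x, a y ^ 2 = b y ^ 2) : ∀ᶠ y in 𝓝 x, a y = b y := by
  have hne : ∀ᶠ y in 𝓝 x, a y + b y ≠ 0 := by
    refine (ha.add hb).eventually_ne ?_
    rw [Pi.add_apply, h, ← two_mul]
    exact mul_ne_zero two_ne_zero h0
  filter_upwards [hne, hsq] with y h1 h2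
  rcases sq_eq_sq_iff_eq_or_eq_neg.1 h2 with h3 | h3
  · exact h3
  · exact absurd (by rw [h3]; ring) h1

/-- A nonvanishing holomorphic function has a local holomorphic square root with a given value. -/
lemma exists_local_sqrt {D : ℂ → ℂ} (hD : Differentiable ℂ D) {p w : ℂ} (hp : D p ≠ 0)
    (hw : w ^ 2 = D p) :
    ∃ U : Set ℂ, IsOpen U ∧ p ∈ U ∧ ∃ ρ : ℂ → ℂ, AnalyticOnNhd ℂ ρ U ∧ ρ p = w ∧
      ∀ z ∈ U, ρ z ^ 2 = D z ∧ ρ z ≠ 0 := by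
  have hcont : Continuous fun z => D z / D p := hD.continuous.div_const _
  have hw0 : w ≠ 0 := by rintro rfl; exact hp (by rw [← hw]; ring)
  have hU : IsOpen ((fun z => D z / D p) ⁻¹' Complex.slitPlane) :=
    Complex.isOpen_slitPlane.preimage hcont
  refine ⟨_, hU, by simp [hp], fun z => w * Complex.exp (Complex.log (D z / D p) / 2), ?_,
    by simp [hp], fun z hz => ⟨?_, mul_ne_zero hw0 (Complex.exp_ne_zero _)⟩⟩
  · refine DifferentiableOn.analyticOnNhd (fun z hz => ?_) hU
    have h1 : DifferentiableAt ℂ (fun z => Complex.log (D z / D p)) z :=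
      ((hD z).div_const _).clog hz
    exact (((h1.div_const 2).cexp).const_mul w).differentiableWithinAt
  · have hz0 : D z / D p ≠ 0 := Complex.slitPlane_ne_zero hz
    rw [mul_pow, hw, ← Complex.exp_nat_mul, Nat.cast_ofNat, mul_div_cancel₀ _ two_ne_zero,
      Complex.exp_log hz0, mul_div_cancel₀ _ hp]

/-- Lift f through the covering exp : ℂ → ℂ∖{0}, starting from the logarithm 0 of 1, and halve the
lift. -/
lemma exists_continuous_sqrt {f : unitInterval → ℂ} (hf : Continuous f) (h0 : ∀ s, f s ≠ 0)
    (h1 : f 0 = 1) : ∃ w : unitInterval → ℂ, Continuous w ∧ (∀ s, w s ^ 2 = f s) ∧ w 0 = 1 := by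
  let φ : C(unitInterval, {z : ℂ // z ≠ 0}) := ⟨fun s => ⟨f s, h0 s⟩, by fun_prop⟩
  have hφ : φ 0 = ⟨Complex.exp 0, Complex.exp_ne_zero 0⟩ := by
    apply Subtype.ext
    simp [φ, h1]
  have hl := Complex.isCoveringMap_exp.liftPath_lifts φ 0 hφ
  have hl0 := Complex.isCoveringMap_exp.liftPath_zero φ 0 hφ
  set l := Complex.isCoveringMap_exp.liftPath φ 0 hφ
  refine ⟨fun s => Complex.exp (l s / 2), by fun_prop, fun s => ?_, by simp [hl0]⟩
  have := congrArg Subtype.val (congrFun hl s)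
  rw [← Complex.exp_nat_mul, Nat.cast_ofNat, mul_div_cancel₀ _ two_ne_zero]
  exact this

end SquareRoots

/-! ### Slit crossings and the sign of the square root -/

section Parity

/-- A nonvanishing function on the unit interval which is locally constant off a finite set and
changes its sign at each point of this set. -/
lemma eq_neg_one_pow_mul_of_sign_changes {M : Finset unitInterval} (h0 : 0 ∉ M) (h1 : 1 ∉ M)
    {σ : unitInterval → ℂ} (hσ : ∀ s ∉ M, ∀ᶠ s' in 𝓝 s, σ s' = σ s)
    (hM : ∀ s ∈ M, ∃ ε : ℂ, (∀ᶠ s' in 𝓝[<] s, σ s' = ε) ∧ ∀ᶠ s' in 𝓝[>] s, σ s' = -ε) :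
    σ 1 = (-1) ^ M.card * σ 0 := by
  classical
  -- One factor -1 for each point already passed compensates the sign changes of σ.
  set τ : unitInterval → ℂ := fun s => σ s * ∏ p ∈ M, if p < s then -1 else 1 with hτ
  have hconst : ∀ (N : Finset unitInterval) (s : unitInterval), s ∉ N →
      ∀ᶠ s' in 𝓝 s, (∏ p ∈ N, if p < s' then (-1 : ℂ) else 1) = ∏ p ∈ N, if p < s then -1 else 1 := by
    intro N s hs
    have : ∀ᶠ s' in 𝓝 s, ∀ p ∈ N, (p < s' ↔ p < s) := by
      rw [Filter.eventually_all_finset]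
      intro p hp
      have hne : p ≠ s := fun h => hs (h ▸ hp)
      rcases lt_or_gt_of_ne hne with h | h
      · filter_upwards [lt_mem_nhds h] with s' hs'
        simp [h, hs']
      · filter_upwards [gt_mem_nhds h] with s' hs'
        exact iff_of_false (lt_asymm hs') (lt_asymm h)
    filter_upwards [this] with s' hs'
    exact Finset.prod_congr rfl fun p hp => by simp only [hs' p hp]
  have hoff : ∀ s ∉ M, ∀ᶠ s' in 𝓝 s, τ s' = τ s := by
    intro s hs
    filter_upwards [hσ s hs, hconst M s hs] with s' h2 h3
    simp only [hτ, h2, h3]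
  -- Punctured neighbourhoods are needed because nothing is assumed about σ at the points of M. The
  -- value on the punctured neighbourhood is locally constant in s, hence constant.
  have hloc : ∀ s, ∃ v, ∀ᶠ s' in 𝓝[≠] s, τ s' = v := by
    intro s
    by_cases hs : s ∈ M
    · obtain ⟨ε, hl, hr⟩ := hM s hs
      have hc := hconst (M.erase s) s (Finset.notMem_erase s M)
      refine ⟨ε * ∏ p ∈ M.erase s, if p < s then -1 else 1, ?_⟩
      rw [← Set.Iio_union_Ioi, nhdsWithin_union, Filter.eventually_sup]
      constructor
      · filter_upwards [hl, nhdsWithin_le_nhds hc, self_mem_nhdsWithin] with s' h2 h3 h4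
        simp only [hτ]
        rw [← Finset.mul_prod_erase M _ hs, h3, h2, if_neg (not_lt.2 (le_of_lt h4)), one_mul]
      · filter_upwards [hr, nhdsWithin_le_nhds hc, self_mem_nhdsWithin] with s' h2 h3 h4
        simp only [hτ]
        rw [← Finset.mul_prod_erase M _ hs, h3, h2, if_pos (Set.mem_Ioi.1 h4)]
        ring
    · exact ⟨τ s, nhdsWithin_le_nhds (hoff s hs)⟩
  have hclopen : IsClopen {s : unitInterval | ∀ᶠ s' in 𝓝[≠] s, τ s' = τ 0} := by
    have key : ∀ s v, (∀ᶠ s' in 𝓝[≠] s, τ s' = v) →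
        ∀ᶠ s₁ in 𝓝 s, ∀ᶠ s' in 𝓝[≠] s₁, τ s' = v := by
      intro s v h
      have h2 := eventually_eventually_nhdsWithin.2 h
      rw [eventually_nhdsWithin_iff] at h2
      filter_upwards [h2] with s₁ h3
      by_cases h4 : s₁ = s
      · rw [h4]; exact h
      · have h5 := h3 h4
        rw [nhdsWithin_eq_nhds.2 (isOpen_compl_singleton.mem_nhds h4)] at h5
        exact nhdsWithin_le_nhds h5
    constructor
    · rw [← isOpen_compl_iff, isOpen_iff_mem_nhds]
      intro s hs
      obtain ⟨v, hv⟩ := hloc s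
      filter_upwards [key s v hv] with s₁ h2 h3
      obtain ⟨x, hx1, hx2⟩ := (h2.and h3).exists
      refine hs ?_
      simp only [Set.mem_ofPred_eq]
      rwa [← hx2, hx1]
    · rw [isOpen_iff_mem_nhds]
      exact fun s hs => key s _ hs
  have huniv := hclopen.eq_univ ⟨0, nhdsWithin_le_nhds (hoff 0 h0)⟩
  have hone : ∀ᶠ s' in 𝓝[≠] (1 : unitInterval), τ s' = τ 0 :=
    (huniv ▸ Set.mem_univ _ : (1 : unitInterval) ∈
      {s : unitInterval | ∀ᶠ s' in 𝓝[≠] s, τ s' = τ 0})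
  obtain ⟨x, hx1, hx2⟩ := (hone.and (nhdsWithin_le_nhds (hoff 1 h1))).exists
  have hτ01 : τ 1 = τ 0 := hx2.symm.trans hx1
  have e0 : τ 0 = σ 0 := by
    simp only [hτ]
    rw [Finset.prod_eq_one fun p _ => if_neg (not_lt.2 unitInterval.nonneg'), mul_one]
  have e1 : τ 1 = σ 1 * (-1) ^ M.card := by
    simp only [hτ]
    rw [Finset.prod_congr rfl fun p hp => if_pos
      (lt_of_le_of_ne unitInterval.le_one' fun h => h1 (h ▸ hp)), Finset.prod_const]
  rw [e0, e1] at hτ01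
  rw [← hτ01, mul_comm, mul_assoc, ← mul_pow]
  simp

/-- Along a path the continued square root and the branch off the slits agree up to the parity of
the number of crossings. -/
lemma SlitSystem.continuation_eq {D : ℂ → ℂ} (hD : Differentiable ℂ D) (S : SlitSystem D)
    (h0 : (0 : ℂ) ∉ S.slits) (h1 : (Real.pi : ℂ) ∉ S.slits) {γ : PiPath}
    (hγ : ∀ s, D (γ s) ≠ 0) {w : unitInterval → ℂ} (hw : Continuous w)
    (hsq : ∀ s, w s ^ 2 = D (γ s)) (hc : CrossesFinitely S.slits γ) :
    w 1 / S.branch Real.pi =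
      (-1) ^ (meetTimes S.slits γ).ncard * (w 0 / S.branch 0) := by
  classical
  have hw0 : ∀ s, w s ≠ 0 := fun s h => hγ s (by rw [← hsq, h]; ring)
  have hr0 : ∀ s, γ s ∉ S.slits → S.branch (γ s) ≠ 0 := fun s hs h =>
    hγ s (by rw [← S.branch_sq _ hs, h]; ring)
  set M := hc.1.toFinset with hM
  have hmem : ∀ s, s ∈ M ↔ γ s ∈ S.slits := fun s => by simp [hM, meetTimes]
  have hopen : IsOpen S.slitsᶜ := S.isClosed_slits.isOpen_compl
  have key := eq_neg_one_pow_mul_of_sign_changes (M := M)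
    (σ := fun s => w s / S.branch (γ s)) (by rw [hmem]; simpa using h0)
    (by rw [hmem]; simpa using h1) ?_ ?_
  · rw [Set.ncard_eq_toFinset_card _ hc.1]
    simpa using key
  · intro s hs
    rw [hmem] at hs
    have hev : ∀ᶠ s' in 𝓝 s, γ s' ∈ S.slitsᶜ :=
      γ.continuous.continuousAt (hopen.mem_nhds hs)
    have hcr : ContinuousAt (fun s' => w s / S.branch (γ s) * S.branch (γ s')) s :=
      continuousAt_const.mul ((S.continuousOn_branch.continuousAt (hopen.mem_nhds hs)).comp
        (f := γ) γ.continuous.continuousAt)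
    have hk : (w s / S.branch (γ s)) ^ 2 = 1 := by
      rw [div_pow, hsq, S.branch_sq _ hs, div_self (hγ s)]
    have := eventually_eq_of_sq_eq hw.continuousAt hcr
      (div_mul_cancel₀ _ (hr0 s hs)).symm
      (mul_ne_zero (div_ne_zero (hw0 s) (hr0 s hs)) (hr0 s hs)) (by
        filter_upwards [hev] with s' hs'
        rw [mul_pow, hk, one_mul, hsq, S.branch_sq _ hs'])
    filter_upwards [this, hev] with s' h2 h3
    rw [div_eq_iff (hr0 s' h3), h2]
  · intro s hs
    have hs' := (hmem s).1 hs
    obtain ⟨W, hW, hpW, ρ, hρ, hρp, hρW⟩ := exists_local_sqrt hD (hγ s) (hsq s)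
    obtain ⟨U, hUW, hU, hpU, A, B, hA, hB, hAc, hBc, -, hAB, hl, hr⟩ :=
      hc.2 s hs' W (hW.mem_nhds hpW)
    have hwρ : ∀ᶠ s' in 𝓝 s, w s' = ρ (γ s') := by
      refine eventually_eq_of_sq_eq hw.continuousAt
        (ContinuousAt.comp (f := γ) (hρ _ hpW).continuousAt γ.continuous.continuousAt)
        hρp.symm (hρW _ hpW).2 ?_
      filter_upwards [γ.continuous.continuousAt (hW.mem_nhds hpW)] with s' h2
      rw [hsq, (hρW _ h2).1]
    -- On a connected side the branch and the local root ρ have the same nonzero square, so they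
    -- differ by a constant sign.
    have hside : ∀ E ⊆ U \ S.slits, IsPreconnected E →
        ∃ ε : ℂ, (ε = 1 ∨ ε = -1) ∧ ∀ z ∈ E, S.branch z = ε * ρ z := by
      intro E hE hEc
      have hEU : E ⊆ W := fun z hz => hUW (hE hz).1
      rcases hEc.eq_or_eq_neg_of_sq_eq (f := S.branch) (g := ρ)
        (S.continuousOn_branch.mono fun z hz => (hE hz).2)
        (fun z hz => (hρ z (hEU hz)).continuousAt.continuousWithinAt)
        (fun z hz => by
          simp only [Pi.pow_apply]
          rw [S.branch_sq z (hE hz).2, (hρW z (hEU hz)).1])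
        (fun {z} hz => (hρW z (hEU hz)).2) with h | h
      · exact ⟨1, Or.inl rfl, fun z hz => by rw [h hz, one_mul]⟩
      · exact ⟨-1, Or.inr rfl, fun z hz => by rw [h hz]; simp⟩
    have hAU : A ⊆ U \ S.slits := hAB ▸ Set.subset_union_left
    have hBU : B ⊆ U \ S.slits := hAB ▸ Set.subset_union_right
    obtain ⟨α, hα, hAα⟩ := hside A hAU hAc
    obtain ⟨β, hβ, hBβ⟩ := hside B hBU hBc
    -- With equal signs on both sides the branch would be a constant multiple of ρ near γ(s) off the
    -- slits, and so would have a limit there.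
    have hne : α ≠ β := by
      rintro rfl
      refine S.no_limit _ hs' (hγ s) ⟨α * ρ (γ s), ?_⟩
      have hlim : Tendsto (fun z => α * ρ z) (𝓝[S.slitsᶜ] (γ s)) (𝓝 (α * ρ (γ s))) :=
        (tendsto_const_nhds.mul (hρ _ hpW).continuousAt).mono_left nhdsWithin_le_nhds
      refine hlim.congr' ?_
      filter_upwards [self_mem_nhdsWithin, nhdsWithin_le_nhds (hU.mem_nhds hpU)] with z h2 h3
      have : z ∈ A ∪ B := hAB ▸ ⟨h3, h2⟩
      rcases this with h | h
      · exact (hAα z h).symm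
      · exact (hBβ z h).symm
    have hβα : β = -α := by
      rcases hα with rfl | rfl <;> rcases hβ with rfl | rfl <;> simp at hne ⊢
    have hαα : α * α = 1 := by rcases hα with rfl | rfl <;> simp
    have hα0 : α ≠ 0 := by rintro rfl; simp at hαα
    refine ⟨α, ?_, ?_⟩
    · filter_upwards [hl, nhdsWithin_le_nhds hwρ] with s' h2 h3
      have hρ0 := (hρW _ (hUW (hAU h2).1)).2
      rw [hAα _ h2, h3, div_eq_iff (mul_ne_zero hα0 hρ0), ← mul_assoc, hαα, one_mul]
    · filter_upwards [hr, nhdsWithin_le_nhds hwρ] with s' h2 h3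
      have hρ0 := (hρW _ (hUW (hBU h2).1)).2
      rw [hBβ _ h2, h3, hβα, div_eq_iff (mul_ne_zero (neg_ne_zero.2 hα0) hρ0), ← mul_assoc,
        neg_mul_neg, hαα, one_mul]

end Parity

/-! ### Values at t = π and comparison of the two Gaussians -/

section Polar

variable {m : ℕ}

lemma differentiable_ampDet (K g : Matrix (Idx m) (Idx m) ℂ) : Differentiable ℂ (ampDet K g) :=
  differentiable_det_ampMatrix (gᵀ * K * g)

lemma ampDet_zero (K g : Matrix (Idx m) (Idx m) ℂ) : ampDet K g 0 = 1 := by simp [ampDet]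

lemma ampMatrix_pi (L : Matrix (Idx m) (Idx m) ℂ) : ampMatrix L (Real.pi : ℂ) = -L := by
  simp [ampMatrix, Complex.cos_pi_div_two, Complex.sin_pi_div_two]

lemma ampDet_pi (K : Matrix (Idx m) (Idx m) ℂ) {g : Matrix (Idx m) (Idx m) ℂ}
    (hg : g ∈ Matrix.symplecticGroup (Fin m) ℂ) : ampDet K g (Real.pi : ℂ) = K.det := by
  rw [ampDet_eq, ampMatrix_pi, Matrix.det_neg, Matrix.det_mul, Matrix.det_mul,
    Matrix.det_transpose, SymplecticGroup.det_eq_one hg, Fintype.card_sum, ← two_mul, pow_mul]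
  simp

lemma gaussianExp_pi (ħ : ℝ) {K g : Matrix (Idx m) (Idx m) ℂ}
    (hg : g ∈ Matrix.symplecticGroup (Fin m) ℂ) (hK : K.det ≠ 0) (r : ℂ) (u : Idx m → ℂ) :
    gaussianExp ħ K g r (Real.pi : ℂ) u =
      r⁻¹ * Complex.exp (-(1 / (Complex.I * ħ)) * qform K⁻¹ u) := by
  have hgu : IsUnit g.det := by rw [SymplecticGroup.det_eq_one hg]; exact isUnit_one
  have hgt : IsUnit (gᵀ).det := by rwa [Matrix.det_transpose]
  have hneg : (-K)⁻¹ = -K⁻¹ := Matrix.inv_eq_right_inv (by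
    rw [Matrix.neg_mul, Matrix.mul_neg, neg_neg,
      Matrix.mul_nonsing_inv _ (isUnit_iff_ne_zero.2 hK)])
  have h1 : phaseMatrix K g (Real.pi : ℂ) = (-1 : ℂ) • K⁻¹ := by
    rw [phaseMatrix, ampMatrix_pi, Complex.sin_pi_div_two, one_smul]
    have : -(gᵀ * K * g) = gᵀ * (-K) * g := by rw [Matrix.mul_neg, Matrix.neg_mul]
    rw [this, Matrix.mul_inv_rev, Matrix.mul_inv_rev, ← Matrix.mul_assoc,
      Matrix.mul_nonsing_inv _ hgu, Matrix.one_mul, Matrix.mul_assoc,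
      Matrix.nonsing_inv_mul _ hgt, Matrix.mul_one, hneg, neg_one_smul]
  rw [gaussianExp, h1, qform_smul]
  congr 2
  ring

/-- The star exponential along a path avoiding the singular points. -/
lemma isStarExpAlong_gaussianExp {ħ : ℝ} (hħ : 0 < ħ) {K g : Matrix (Idx m) (Idx m) ℂ}
    (hK : K.IsSymm) (hg : g ∈ Matrix.symplecticGroup (Fin m) ℂ) {γ : PiPath} (hγ : Avoids K g γ)
    {w : unitInterval → ℂ} (hw : Continuous w) (hsq : ∀ s, w s ^ 2 = ampDet K g (γ s))
    (hw0 : w 0 = 1) :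
    IsStarExpAlong ħ K (quadHam ħ K g) γ fun s u => gaussianExp ħ K g (w s) (γ s) u := by
  refine ⟨fun u => by simp [gaussianExp, hw0, phaseMatrix, qform], fun s => ?_⟩
  obtain ⟨U, hU, hpU, ρ, hρ, hρp, hρU⟩ :=
    exists_local_sqrt (differentiable_ampDet K g) (hγ s) (hsq s)
  have hD : ∀ z ∈ U, ampDet K g z ≠ 0 := fun z hz => by
    rw [← (hρU z hz).1]
    exact pow_ne_zero 2 (hρU z hz).2
  refine ⟨U, hU, hpU, fun t u => gaussianExp ħ K g (ρ t) t u, ?_, fun t ht u => ?_, ?_⟩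
  · rintro ⟨t, u⟩ ⟨ht, -⟩
    exact analyticAt_gaussianExp ħ (hD t ht) (hρ t ht) (hρU t ht).2 u
  · refine hasDerivAt_gaussianExp hħ hK hg (hD t ht) (hρ t ht).differentiableAt ?_ u
    filter_upwards [hU.mem_nhds ht] with z hz
    exact (hρU z hz).1
  · have : ∀ᶠ s' in 𝓝 s, w s' = ρ (γ s') := by
      refine eventually_eq_of_sq_eq hw.continuousAt
        (ContinuousAt.comp (f := γ) (hρ _ hpU).continuousAt γ.continuous.continuousAt)
        hρp.symm (hρU _ hpU).2 ?_
      filter_upwards [γ.continuous.continuousAt (hU.mem_nhds hpU)] with s' h2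
      rw [hsq, (hρU _ h2).1]
    filter_upwards [this] with s' h2 u
    rw [h2]

lemma fourth_root_of_unity {c : ℂ} (h : c ^ 2 = (-1) ^ m) :
    c = 1 ∨ c = -1 ∨ c = Complex.I ∨ c = -Complex.I := by
  rcases neg_one_pow_eq_or ℂ m with h1 | h1
  · rw [h1] at h
    rcases sq_eq_one_iff.1 h with h | h <;> simp [h]
  · rw [h1, ← Complex.I_sq] at h
    rcases sq_eq_sq_iff_eq_or_eq_neg.1 h with h | h <;> simp [h]

/-- The common value at `0` of the delta functions, or a number with the same square when there
is none. -/
lemma exists_starDelta_value {ħ : ℝ} (hħ : 0 < ħ) {K : Matrix (Idx m) (Idx m) ℂ}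
    (hdet : K.det ≠ 0) : ∃ ζ : ℂ, ζ ^ 2 * K.det = (-4) ^ m ∧
      ∀ V : VSpace m, VClass ħ V K → starDelta ħ V K 0 = ζ := by
  by_cases h : ∃ V : VSpace m, VClass ħ V K
  · obtain ⟨V, hV⟩ := h
    exact ⟨starDelta ħ V K 0, (hV.posOn hħ).starDelta_zero_sq hħ, fun W hW =>
      (hW.posOn hħ).starDelta_zero_eq hħ (hV.posOn hħ)⟩
  -- With no V available the comparison is vacuous, but c(γ) must still be a fourth root of unity,
  -- so any ζ with the right square serves.
  · obtain ⟨ζ, hζ⟩ := IsAlgClosed.exists_pow_nat_eq ((-4) ^ m / K.det) two_pos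
    exact ⟨ζ, by rw [hζ, div_mul_cancel₀ _ hdet], fun V hV => absurd ⟨V, hV⟩ h⟩

lemma ratio_sq {ζ d w : ℂ} (hζ : ζ ^ 2 * d = (-4) ^ m) (hw : w ^ 2 = d) :
    (2 ^ m / (w * ζ)) ^ 2 = (-1) ^ m := by
  have h4 : ((-4 : ℂ)) ^ m ≠ 0 := pow_ne_zero m (by norm_num)
  rw [div_pow, mul_pow, hw, mul_comm d, hζ, ← pow_mul, mul_comm m, pow_mul, ← div_pow]
  norm_num

end Polar

end PolarElement

end

theorem mainTheorem4 (m : ℕ) (ħ : ℝ) (hħ : 0 < ħ)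
    (K : Matrix (PolarElement.Idx m) (PolarElement.Idx m) ℂ) (hK : K.IsSymm)
    (g : Matrix (PolarElement.Idx m) (PolarElement.Idx m) ℂ)
    (hg : g ∈ Matrix.symplecticGroup (Fin m) ℂ) :
    ∃ c : PolarElement.PiPath → ℂ,
      -- the polar element along every path avoiding the singular points
      (∀ γ : PolarElement.PiPath, PolarElement.Avoids K g γ →
        (c γ = 1 ∨ c γ = -1 ∨ c γ = Complex.I ∨ c γ = -Complex.I) ∧
        ∃ F : unitInterval → (PolarElement.Idx m → ℂ) → ℂ,
          PolarElement.IsStarExpAlong ħ K (PolarElement.quadHam ħ K g) γ F ∧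
          (∀ F', PolarElement.IsStarExpAlong ħ K (PolarElement.quadHam ħ K g) γ F' → F' = F) ∧
          ∀ V : PolarElement.VSpace m, PolarElement.VClass ħ V K →
            ∀ u, F 1 u = c γ * ((2 : ℂ) ^ m)⁻¹ * PolarElement.starDelta ħ V K u) ∧
      -- dependence on the parity of the number of slit crossings
      (∀ S : PolarElement.SlitSystem (PolarElement.ampDet K g),
        (0 : ℂ) ∉ S.slits → (Real.pi : ℂ) ∉ S.slits →
        ∃ c₀ : ℂ, (c₀ = 1 ∨ c₀ = -1 ∨ c₀ = Complex.I ∨ c₀ = -Complex.I) ∧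
          ∀ γ : PolarElement.PiPath, PolarElement.Avoids K g γ →
            PolarElement.CrossesFinitely S.slits γ →
            c γ = (-1) ^ (PolarElement.meetTimes S.slits γ).ncard * c₀) := by
  open PolarElement in
  -- Since D(π) = det K, in this case π is itself singular and no path to it is admissible.
  by_cases hdet : K.det = 0
  · have hno : ∀ γ : PiPath, ¬ Avoids K g γ := fun γ h =>
      h 1 (by rw [γ.target, ampDet_pi K hg, hdet])
    exact ⟨fun _ => 1, fun γ h => absurd h (hno γ), fun S _ _ =>
      ⟨1, Or.inl rfl, fun γ h => absurd h (hno γ)⟩⟩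
  obtain ⟨ζ, hζ, hζV⟩ := exists_starDelta_value hħ hdet
  have hζ0 : ζ ≠ 0 := by
    rintro rfl
    exact pow_ne_zero m (by norm_num : (-4 : ℂ) ≠ 0) (by rw [← hζ]; ring)
  have hlift : ∀ γ : PiPath, ∃ w : unitInterval → ℂ, Avoids K g γ →
      Continuous w ∧ (∀ s, w s ^ 2 = ampDet K g (γ s)) ∧ w 0 = 1 := by
    intro γ
    by_cases h : Avoids K g γ
    · obtain ⟨w, hw⟩ := exists_continuous_sqrt
        ((differentiable_ampDet K g).continuous.comp γ.continuous) h
        (by simp [ampDet_zero])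
      exact ⟨w, fun _ => hw⟩
    · exact ⟨0, fun h' => absurd h' h⟩
  choose w hw using hlift
  have hw1 : ∀ γ, Avoids K g γ → w γ 1 ^ 2 = K.det := fun γ h => by
    rw [(hw γ h).2.1, γ.target, ampDet_pi K hg]
  have hwne : ∀ γ, Avoids K g γ → w γ 1 ≠ 0 := fun γ h h0 =>
    hdet (by rw [← hw1 γ h, h0]; ring)
  have h2m : (2 : ℂ) ^ m ≠ 0 := pow_ne_zero m two_ne_zero
  -- The polar element has amplitude 1/w(1) and the delta function amplitude ζ, so w(1)⁻¹ = c ·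
  -- 2^{-m} · ζ forces this value.
  refine ⟨fun γ => 2 ^ m / (w γ 1 * ζ), fun γ hγ => ?_, fun S h0 h1 => ?_⟩
  · obtain ⟨hc, hsq, hone⟩ := hw γ hγ
    have hF := isStarExpAlong_gaussianExp hħ hK hg hγ hc hsq hone
    refine ⟨fourth_root_of_unity (ratio_sq hζ (hw1 γ hγ)), _, hF, fun F' hF' => ?_,
      fun V hV u => ?_⟩
    · have hA : (g * gᵀ).IsSymm := by simp [Matrix.IsSymm]
      rw [quadHam_eq hħ] at hF hF'
      exact hF.unique hA hF'
    · have := hwne γ hγ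
      rw [γ.target, gaussianExp_pi ħ hg hdet, (hV.posOn hħ).starDelta_eq_mul_exp hħ, hζV V hV]
      field_simp
  · have hb0 : S.branch 0 ^ 2 = 1 := by rw [S.branch_sq _ h0, ampDet_zero]
    have hbpi : S.branch Real.pi ^ 2 = K.det := by rw [S.branch_sq _ h1, ampDet_pi K hg]
    have hb0' : S.branch 0 ≠ 0 := by intro h; rw [h] at hb0; norm_num at hb0
    have hbpi' : S.branch Real.pi ≠ 0 := by
      intro h; rw [h] at hbpi; exact hdet (by rw [← hbpi]; ring)
    -- The given branch may start at -1 instead of 1; the factor `S.branch 0` corrects for this.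
    refine ⟨S.branch 0 * (2 ^ m / (S.branch Real.pi * ζ)), fourth_root_of_unity (m := m) ?_,
      fun γ hγ hcr => ?_⟩
    · rw [mul_pow, hb0, one_mul, ratio_sq hζ hbpi]
    · obtain ⟨hc, hsq, hone⟩ := hw γ hγ
      have key := S.continuation_eq (differentiable_ampDet K g) h0 h1 hγ hc hsq hcr
      have hne := hwne γ hγ
      rw [hone] at key
      have hsign : ((-1 : ℂ) ^ (meetTimes S.slits γ).ncard) ^ 2 = 1 := by
        rw [← pow_mul, mul_comm, pow_mul]; norm_num
      set e := (-1 : ℂ) ^ (meetTimes S.slits γ).ncard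
      have he0 : e ≠ 0 := by intro h; rw [h] at hsign; norm_num at hsign
      rw [div_eq_iff hbpi'] at key
      change 2 ^ m / (w γ 1 * ζ) = _
      rw [key]
      field_simp
      exact hsign.symm
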